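/- **Theorem (Formal separatrix).** Assign to the variables $x,y,\varepsilon$ the weights $2,3,4$, and call a real polynomial in $x,y,\varepsilon$ quasi-homogeneous of order $p$ if all its monomials $x^iy^j\varepsilon^k$ satisfy $2i+3j+4k=p$. Let $$h_\varepsilon=\sum_{p\ge 6}h_p(x,y,\varepsilon)$$ be a formal power series with real coefficients, where $h_p$ is quasi-homogeneous of order $p$ and $$h_6=\frac{y^2}{2}+\frac{a x^3}{3}-b\,x\,\varepsilon,\qquad a,b>0.$$ Put $\varepsilon=\delta^4$ and $\eta_0(t)=\cosh^{-2}\frac t2$, let a dot denote $d/dt$, and let $\mathrm J\nabla h_\varepsilon=(\partial_y h_\varepsilon,-\partial_x h_\varepsilon)$. Then there is a unique formal series $$\mu(\delta)=\sum_{k\ge 0}\mu_k\delta^{2k+1},\qquad \mu_k\in\mathbb R,\quad \mu_0>0,$$ such that the equation $$\mu(\delta)\,\dot{\mathbf X}=\mathrm J\nabla h_\varepsilon(\mathbf X)$$ (understood as an equality of formal power series in $\delta$ whose coefficients are functions of $t$) has a formal solution that is not constant in $t$ and has the form $$\mathbf X(t,\varepsilon)=\begin{pmatrix}\displaystyle\sum_{p\ge1}\delta^{2p}X^1_p+\dot\eta_0\sum_{p\ge1}\delta^{2p+1}X^2_{p-1}\\[2mm]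 \displaystyle\dot\eta_0\sum_{p\ge1}\delta^{2p+1}Y^2_{p-1}+\sum_{p\ge2}\delta^{2p}Y^1_p\end{pmatrix},$$ where $X^1_p,X^2_p,Y^1_p,Y^2_p$ are polynomials in $\eta_0$ with real coefficients of degree at most $p$. Moreover, without the condition $\mu_0>0$ such a series $\mu$ is unique up to sign. -/

import Mathlib

noncomputable section

namespace FormalSeparatrix

open Polynomial

/-- The quasi-homogeneous weights: `x`, `y`, `ε` (the variables `0`, `1`, `2`) are of order
`2`, `3`, `4`. -/
def qWeight : Fin 3 → ℕ := ![2, 3, 4]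

/-- The polynomial `y ^ 2 / 2 + a x ^ 3 / 3 - b x ε`, quasi-homogeneous of order `6`. -/
def leadingHamiltonian (a b : ℝ) : MvPolynomial (Fin 3) ℝ :=
  MvPolynomial.C (1 / 2) * MvPolynomial.X 1 ^ 2
    + MvPolynomial.C (a / 3) * MvPolynomial.X 0 ^ 3
    - MvPolynomial.C b * MvPolynomial.X 0 * MvPolynomial.X 2

/-- `h = ∑_{p ≥ 6} h_p` with `h_p` quasi-homogeneous of order `p` and
`h_6 = y ^ 2 / 2 + a x ^ 3 / 3 - b x ε`. The term `h_p` collects the monomials `x ^ i y ^ j ε ^ k`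
with `2 i + 3 j + 4 k = p`. -/
structure IsFormalHamiltonian (h : MvPowerSeries (Fin 3) ℝ) (a b : ℝ) : Prop where
  order_ge : ∀ d : Fin 3 →₀ ℕ, Finsupp.weight qWeight d < 6 → MvPowerSeries.coeff d h = 0
  leading : ∀ d : Fin 3 →₀ ℕ, Finsupp.weight qWeight d = 6 →
    MvPowerSeries.coeff d h = MvPolynomial.coeff d (leadingHamiltonian a b)

/-- The function `η₀(t) = 1 / cosh² (t / 2)`. -/
def eta0 : ℝ → ℝ := fun t => 1 / Real.cosh (t / 2) ^ 2

/-- The ring of formal power series in `δ` whose coefficients are functions of the time `t`. -/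
abbrev TimeSeries : Type := PowerSeries (ℝ → ℝ)

/-- Differentiation with respect to `t`, coefficient by coefficient. -/
def timeDeriv (Z : TimeSeries) : TimeSeries := PowerSeries.mk fun n => deriv (PowerSeries.coeff n Z)

/-- A real formal series in `δ`, viewed as a series whose coefficients are constant in `t`. -/
def constInTime (μ : PowerSeries ℝ) : TimeSeries := PowerSeries.map (algebraMap ℝ (ℝ → ℝ)) μ

/-- `F(X, Y, ε)` with `ε = δ ^ 4`, as a formal series in `δ`. -/
def evalAlong (X Y : TimeSeries) (F : MvPowerSeries (Fin 3) ℝ) : TimeSeries :=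
  MvPowerSeries.subst ![X, Y, PowerSeries.X ^ 4] F

/-- The pair `(X, Y)` has the form
`X = ∑_{p ≥ 1} δ ^ (2 p) X¹_p + η₀' ∑_{p ≥ 1} δ ^ (2 p + 1) X²_{p - 1}`,
`Y = η₀' ∑_{p ≥ 1} δ ^ (2 p + 1) Y²_{p - 1} + ∑_{p ≥ 2} δ ^ (2 p) Y¹_p`,
where `X¹_p`, `X²_p`, `Y¹_p`, `Y²_p` are real polynomials in `η₀` of degree at most `p`. -/
def HasSeparatrixForm (X Y : TimeSeries) : Prop :=
  ∃ X₁ X₂ Y₁ Y₂ : ℕ → ℝ[X],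
    (∀ p, (X₁ p).natDegree ≤ p ∧ (X₂ p).natDegree ≤ p ∧
      (Y₁ p).natDegree ≤ p ∧ (Y₂ p).natDegree ≤ p) ∧
    (∀ n < 2, PowerSeries.coeff n X = 0) ∧
    (∀ p ≥ 1, PowerSeries.coeff (2 * p) X = aeval eta0 (X₁ p)) ∧
    (∀ p ≥ 1, PowerSeries.coeff (2 * p + 1) X = deriv eta0 * aeval eta0 (X₂ (p - 1))) ∧
    (∀ n < 3, PowerSeries.coeff n Y = 0) ∧
    (∀ p ≥ 2, PowerSeries.coeff (2 * p) Y = aeval eta0 (Y₁ p)) ∧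
    (∀ p ≥ 1, PowerSeries.coeff (2 * p + 1) Y = deriv eta0 * aeval eta0 (Y₂ (p - 1)))

/-- The substitution in `evalAlong` is legitimate for every pair of the required form. -/
theorem HasSeparatrixForm.hasSubst {X Y : TimeSeries} (hXY : HasSeparatrixForm X Y) :
    MvPowerSeries.HasSubst (![X, Y, PowerSeries.X ^ 4] : Fin 3 → TimeSeries) := by
  obtain ⟨_, _, _, _, _, hX, _, _, hY, _, _⟩ := hXY
  have h0 := hX 0 (by norm_num)
  have h1 := hY 0 (by norm_num)
  rw [PowerSeries.coeff_zero_eq_constantCoeff_apply] at h0 h1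
  refine MvPowerSeries.hasSubst_of_constantCoeff_zero fun i => ?_
  fin_cases i
  · exact h0
  · exact h1
  · change PowerSeries.constantCoeff (PowerSeries.X ^ 4 : TimeSeries) = 0
    simp

/-- The formal series `μ` is odd: `μ = ∑_{k ≥ 0} μ_k δ ^ (2 k + 1)`. -/
def IsOddSeries (μ : PowerSeries ℝ) : Prop := ∀ k : ℕ, PowerSeries.coeff (2 * k) μ = 0

/-- The equation `μ(δ) (X', Y') = J ∇ h (X, Y) = (∂h/∂y, -∂h/∂x)(X, Y, δ ^ 4)` has a formal
solution of the form described in `HasSeparatrixForm` that is not an equilibrium, that is, not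
constant in `t`. -/
def HasFormalSeparatrix (h : MvPowerSeries (Fin 3) ℝ) (μ : PowerSeries ℝ) : Prop :=
  ∃ X Y : TimeSeries, HasSeparatrixForm X Y ∧ ¬ (timeDeriv X = 0 ∧ timeDeriv Y = 0) ∧
    constInTime μ * timeDeriv X = evalAlong X Y (MvPowerSeries.pderiv ℝ 1 h) ∧
    constInTime μ * timeDeriv Y = - evalAlong X Y (MvPowerSeries.pderiv ℝ 0 h)

end FormalSeparatrix

end

noncomputable section

namespace FormalSeparatrix

open Polynomial

/-! With `s = tanh (t / 2)` one has `η₀ = 1 - s ^ 2`, `η₀' = -s (1 - s ^ 2)` and `d/dt = (1 - s ^ 2)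
/ 2 * d/ds`. A solution of the required form is therefore a pair of series in `δ` over `ℝ[s]`, and
the times `t = ±∞` become the points `s = ±1`, where `d/dt` vanishes and the orbit sits at an
equilibrium.

Uniqueness up to sign. The lowest order of the equation, together with nonconstancy, forces the
leading coefficient of `X` to be `-√(b/a) + β η₀` with `β ≠ 0` (`IsOrbit.constant`,
`IsOrbit.leading`). Its value at `s = 1` determines the whole equilibrium (`equilibrium_unique`).
Differentiating the equation in `s` at `s = 1` shows that `-μ` is an eigenvalue of the linearization
`J Hess h` at this equilibrium. Its trace is zero, so `μ ^ 2` is minus its determinant and depends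
only on `h` (`IsOrbit.sq_eq`).

Existence. Put `κ = √(b/a)` and `m₀ = √(2 a κ)`. The leading pair is `x₀ = -κ + 3 κ η₀`, `y₀ = m₀
x₀'`, and corrections are added one order at a time (`IsApproxOrbit.exists_succ`). After elimination
of the correction of `Y`, each step asks for `L ξ = G`, where `L = d²/dt² - 1 + 3 η₀` and `G` also
contains a free multiple of `η₀''` coming from the next coefficient of `μ`. At even relative order
`G` is a polynomial in `η₀`. The image of `L` on such polynomials, of one degree less, together with
`η₀''`, contains all of them, so the coefficient of `μ` removes the obstruction
(`exists_lameOp_eq`). At odd relative order `μ` may not be changed. The equation is solved by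
reduction of order from `L η₀' = 0` (`exists_lameOp_eq_odd`), and the result is a polynomial for two
reasons: `η₀' G` is the derivative of a polynomial, by conservation of `h` (`tDeriv_energy`), and
`G` vanishes doubly at `s = ±1`, because both ends of the orbit lie at the same equilibrium
(`wronskian`, `eval_derivative_eq_zero`). Degrees and parities in `s` are carried along by
`IsGraded`, which encodes the required form of the solution. -/

/-- Every monomial of `F` has weighted order at least `w`. -/
def OrderGE (w : ℕ) (F : MvPowerSeries (Fin 3) ℝ) : Prop :=
  ∀ d : Fin 3 →₀ ℕ, Finsupp.weight qWeight d < w → MvPowerSeries.coeff d F = 0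

theorem weight_qWeight (d : Fin 3 →₀ ℕ) :
    Finsupp.weight qWeight d = 2 * d 0 + 3 * d 1 + 4 * d 2 := by
  rw [Finsupp.weight_eq_sum, Fin.sum_univ_three]
  simp [qWeight, mul_comm]

theorem OrderGE.mono {v w : ℕ} {F : MvPowerSeries (Fin 3) ℝ} (hF : OrderGE w F) (h : v ≤ w) :
    OrderGE v F := fun d hd => hF d (lt_of_lt_of_le hd h)

theorem OrderGE.pderiv {v w : ℕ} {F : MvPowerSeries (Fin 3) ℝ} (hF : OrderGE w F) (i : Fin 3)
    (h : v + qWeight i ≤ w) : OrderGE v (MvPowerSeries.pderiv ℝ i F) := by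
  intro d hd
  rw [MvPowerSeries.coeff_pderiv, hF, zero_mul]
  rw [map_add, Finsupp.weight_single, one_smul]
  omega

/-- Each power series agrees with a polynomial up to any given weighted order. -/
theorem exists_polynomial_approx (F : MvPowerSeries (Fin 3) ℝ) (w : ℕ) :
    ∃ p : MvPolynomial (Fin 3) ℝ, (∀ d, MvPolynomial.coeff d p ≠ 0 →
      MvPowerSeries.coeff d F ≠ 0) ∧ OrderGE w (F - p) := by
  classical
  have hfin : {d : Fin 3 →₀ ℕ | Finsupp.weight qWeight d < w}.Finite :=
    Finsupp.finite_of_nat_weight_lt qWeight (fun i => by fin_cases i <;> simp [qWeight]) w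
  refine ⟨MvPowerSeries.truncFinset ℝ hfin.toFinset F, fun d hd => ?_, fun d hd => ?_⟩
  · rw [MvPowerSeries.coeff_truncFinset] at hd
    split_ifs at hd with h
    · exact hd
    · exact absurd rfl hd
  · rw [map_sub, MvPolynomial.coeff_coe, MvPowerSeries.coeff_truncFinset_of_mem, sub_self]
    simpa using hd

/-! ### Substitution into power series and the weighted order -/

section Substitution

variable {B : Type*} [CommRing B]

/-- `X` and `Y` are divisible by `δ ^ 2` and `δ ^ 3`. -/
def HasWeights (X Y : PowerSeries B) : Prop :=
  (PowerSeries.X : PowerSeries B) ^ 2 ∣ X ∧ (PowerSeries.X : PowerSeries B) ^ 3 ∣ Y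

theorem HasWeights.hasSubst {X Y : PowerSeries B} (h : HasWeights X Y) :
    MvPowerSeries.HasSubst (![X, Y, PowerSeries.X ^ 4] : Fin 3 → PowerSeries B) := by
  have h0 := PowerSeries.X_pow_dvd_iff.1 h.1 0 (by norm_num)
  have h1 := PowerSeries.X_pow_dvd_iff.1 h.2 0 (by norm_num)
  rw [PowerSeries.coeff_zero_eq_constantCoeff_apply] at h0 h1
  refine MvPowerSeries.hasSubst_of_constantCoeff_zero fun i => ?_
  fin_cases i
  · exact h0
  · exact h1
  · change PowerSeries.constantCoeff (PowerSeries.X ^ 4 : PowerSeries B) = 0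
    simp

theorem HasWeights.monomial_dvd {X Y : PowerSeries B} (h : HasWeights X Y) (d : Fin 3 →₀ ℕ) :
    (PowerSeries.X : PowerSeries B) ^ Finsupp.weight qWeight d
      ∣ X ^ d 0 * Y ^ d 1 * (PowerSeries.X ^ 4) ^ d 2 := by
  rw [weight_qWeight, pow_add, pow_add, pow_mul, pow_mul, pow_mul]
  exact mul_dvd_mul (mul_dvd_mul (pow_dvd_pow_of_dvd h.1 _) (pow_dvd_pow_of_dvd h.2 _)) dvd_rfl

theorem eq_zero_of_forall_X_pow_dvd {z : PowerSeries B}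
    (h : ∀ N : ℕ, (PowerSeries.X : PowerSeries B) ^ N ∣ z) : z = 0 := by
  ext n
  simpa using PowerSeries.X_pow_dvd_iff.1 (h (n + 1)) n (Nat.lt_succ_self n)

variable [Algebra ℝ B]

/-- `F(X, Y, δ ^ 4)` for series `X`, `Y` in `δ` over an arbitrary real algebra. -/
def substAlong (X Y : PowerSeries B) (F : MvPowerSeries (Fin 3) ℝ) : PowerSeries B :=
  MvPowerSeries.subst ![X, Y, PowerSeries.X ^ 4] F

/-- Substitution along `(X, Y, δ ^ 4)` as a linear map. -/
def substLinear {X Y : PowerSeries B} (h : HasWeights X Y) :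
    MvPowerSeries (Fin 3) ℝ →ₗ[ℝ] PowerSeries B :=
  (MvPowerSeries.substAlgHom h.hasSubst).toLinearMap

@[simp]
theorem substLinear_apply {X Y : PowerSeries B} (h : HasWeights X Y)
    (F : MvPowerSeries (Fin 3) ℝ) : substLinear h F = substAlong X Y F := by
  simp [substLinear, substAlong]

theorem substAlong_sub {X Y : PowerSeries B} (h : HasWeights X Y)
    (F G : MvPowerSeries (Fin 3) ℝ) :
    substAlong X Y (F - G) = substAlong X Y F - substAlong X Y G :=
  MvPowerSeries.subst_sub h.hasSubst F G

theorem substAlong_coe (X Y : PowerSeries B) (p : MvPolynomial (Fin 3) ℝ) :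
    substAlong X Y (p : MvPowerSeries (Fin 3) ℝ)
      = MvPolynomial.aeval ![X, Y, PowerSeries.X ^ 4] p :=
  MvPowerSeries.subst_coe p

theorem substAlong_monomial (X Y : PowerSeries B) (d : Fin 3 →₀ ℕ) :
    substAlong X Y (MvPowerSeries.monomial d (1 : ℝ))
      = X ^ d 0 * Y ^ d 1 * (PowerSeries.X ^ 4) ^ d 2 := by
  rw [← MvPolynomial.coe_monomial, substAlong_coe, MvPolynomial.aeval_monomial,
    Finsupp.prod_fintype _ _ (by simp), Fin.prod_univ_three]
  simp

theorem coeff_substAlong {X Y : PowerSeries B} (h : HasWeights X Y)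
    (F : MvPowerSeries (Fin 3) ℝ) (n : ℕ) :
    PowerSeries.coeff n (substAlong X Y F) = finsum fun d : Fin 3 →₀ ℕ =>
      MvPowerSeries.coeff d F • PowerSeries.coeff n
        (X ^ d 0 * Y ^ d 1 * (PowerSeries.X ^ 4) ^ d 2) := by
  refine (MvPowerSeries.coeff_subst h.hasSubst F _).trans (finsum_congr fun d => ?_)
  rw [Finsupp.prod_fintype _ _ (by simp), Fin.prod_univ_three]
  rfl

theorem X_pow_dvd_substAlong {X Y : PowerSeries B} (h : HasWeights X Y) {w : ℕ}
    {F : MvPowerSeries (Fin 3) ℝ} (hF : OrderGE w F) :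
    (PowerSeries.X : PowerSeries B) ^ w ∣ substAlong X Y F := by
  rw [PowerSeries.X_pow_dvd_iff]
  intro n hn
  rw [coeff_substAlong h]
  refine finsum_eq_zero_of_forall_eq_zero fun d => ?_
  rcases lt_or_ge (Finsupp.weight qWeight d) w with hd | hd
  · rw [hF d hd, zero_smul]
  · rw [PowerSeries.X_pow_dvd_iff.1 (h.monomial_dvd d) n (by omega), smul_zero]

/-- A linear map that is continuous for the weighted order takes values in a closed submodule as
soon as it does so on the monomials that occur. -/
theorem mem_of_monomial_mem (Φ : MvPowerSeries (Fin 3) ℝ →ₗ[ℝ] PowerSeries B)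
    (K : Submodule ℝ (PowerSeries B))
    (hK : ∀ z, (∀ N : ℕ, ∃ z' ∈ K, (PowerSeries.X : PowerSeries B) ^ N ∣ z - z') → z ∈ K)
    (hΦ : ∀ N : ℕ, ∃ w, ∀ F, OrderGE w F → (PowerSeries.X : PowerSeries B) ^ N ∣ Φ F)
    (F : MvPowerSeries (Fin 3) ℝ)
    (hF : ∀ d, MvPowerSeries.coeff d F ≠ 0 → Φ (MvPowerSeries.monomial d 1) ∈ K) : Φ F ∈ K := by
  refine hK _ fun N => ?_
  obtain ⟨w, hw⟩ := hΦ N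
  obtain ⟨p, hp, hpF⟩ := exists_polynomial_approx F w
  refine ⟨Φ p, ?_, by simpa using hw _ hpF⟩
  have hsum : (p : MvPowerSeries (Fin 3) ℝ) = ∑ d ∈ p.support,
      MvPolynomial.coeff d p • MvPowerSeries.monomial d (1 : ℝ) := by
    conv_lhs => rw [p.as_sum]
    rw [← MvPolynomial.coeToMvPowerSeries.ringHom_apply, map_sum]
    refine Finset.sum_congr rfl fun d _ => ?_
    rw [MvPolynomial.coeToMvPowerSeries.ringHom_apply, MvPolynomial.coe_monomial, ← map_smul,
      smul_eq_mul, mul_one]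
  rw [hsum, map_sum]
  refine K.sum_mem fun d hd => ?_
  rw [map_smul]
  exact K.smul_mem _ (hF d (hp d (MvPolynomial.mem_support_iff.1 hd)))

/-- Changing `X` by `O(δ ^ (k + 2))` and `Y` by `O(δ ^ (k + 3))` changes a series of weighted
order `w` by `O(δ ^ (w + k))`. -/
theorem X_pow_dvd_substAlong_sub {X Y X' Y' : PowerSeries B} (h : HasWeights X Y)
    (h' : HasWeights X' Y') {k w : ℕ} (hX : (PowerSeries.X : PowerSeries B) ^ (k + 2) ∣ X' - X)
    (hY : (PowerSeries.X : PowerSeries B) ^ (k + 3) ∣ Y' - Y)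
    {F : MvPowerSeries (Fin 3) ℝ} (hF : OrderGE w F) :
    (PowerSeries.X : PowerSeries B) ^ (w + k) ∣ substAlong X' Y' F - substAlong X Y F := by
  -- A product rule for differences: the gain `k` survives multiplication, while the orders `m` and
  -- `n` add.
  have hmul : ∀ {m n : ℕ} {u u' v v' : PowerSeries B},
      (PowerSeries.X : PowerSeries B) ^ m ∣ u → (PowerSeries.X : PowerSeries B) ^ n ∣ v' →
      (PowerSeries.X : PowerSeries B) ^ (m + k) ∣ u' - u →
      (PowerSeries.X : PowerSeries B) ^ (n + k) ∣ v' - v →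
      (PowerSeries.X : PowerSeries B) ^ (m + n + k) ∣ u' * v' - u * v := by
    intro m n u u' v v' hu hv hu' hv'
    have : u' * v' - u * v = (u' - u) * v' + u * (v' - v) := by ring
    rw [this]
    refine dvd_add ?_ ?_
    · rw [show m + n + k = m + k + n by ring, pow_add]
      exact mul_dvd_mul hu' hv
    · rw [show m + n + k = m + (n + k) by ring, pow_add]
      exact mul_dvd_mul hu hv'
  have hpow : ∀ {m : ℕ} {u u' : PowerSeries B} (i : ℕ),
      (PowerSeries.X : PowerSeries B) ^ m ∣ u → (PowerSeries.X : PowerSeries B) ^ m ∣ u' →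
      (PowerSeries.X : PowerSeries B) ^ (m + k) ∣ u' - u →
      (PowerSeries.X : PowerSeries B) ^ (m * i + k) ∣ u' ^ i - u ^ i := by
    intro m u u' i hu hu' hd
    induction i with
    | zero => simp
    | succ i ih =>
      rw [pow_succ, pow_succ, Nat.mul_succ]
      refine hmul ?_ hu' ih hd
      rw [pow_mul]
      exact pow_dvd_pow_of_dvd hu i
  let K : Submodule ℝ (PowerSeries B) :=
    { carrier := {z | (PowerSeries.X : PowerSeries B) ^ (w + k) ∣ z}
      add_mem' := fun hx hy => dvd_add hx hy
      zero_mem' := dvd_zero _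
      smul_mem' := fun c z hz => by
        change _ ∣ c • z
        rw [Algebra.smul_def]
        exact dvd_mul_of_dvd_right hz _ }
  have := mem_of_monomial_mem (substLinear h' - substLinear h) K
    (fun z hz => by
      obtain ⟨z', hz', hd⟩ := hz (w + k)
      exact (dvd_sub_left hz').1 hd)
    (fun N => ⟨N, fun G hG => by
      simpa using dvd_sub (X_pow_dvd_substAlong h' hG) (X_pow_dvd_substAlong h hG)⟩) F
    (fun d hd => by
      have hwd : w ≤ Finsupp.weight qWeight d := by
        by_contra hlt
        exact hd (hF d (not_le.1 hlt))
      simp only [LinearMap.sub_apply, substLinear_apply, substAlong_monomial]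
      refine (pow_dvd_pow _ (Nat.add_le_add_right hwd k)).trans ?_
      rw [weight_qWeight]
      have e : ∀ i j : ℕ, (PowerSeries.X : PowerSeries B) ^ (2 * i + 3 * j) ∣ X ^ i * Y ^ j := by
        intro i j
        rw [pow_add, pow_mul, pow_mul]
        exact mul_dvd_mul (pow_dvd_pow_of_dvd h.1 _) (pow_dvd_pow_of_dvd h.2 _)
      refine hmul (e _ _) (by rw [← pow_mul]) ?_ (by simp)
      refine hmul ?_ ?_ (hpow _ h.1 h'.1 (by rwa [add_comm])) (hpow _ h.2 h'.2 (by rwa [add_comm]))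
      · rw [pow_mul]; exact pow_dvd_pow_of_dvd h.1 _
      · rw [pow_mul]; exact pow_dvd_pow_of_dvd h'.2 _)
  rw [LinearMap.sub_apply, substLinear_apply, substLinear_apply] at this
  exact this

/-- The chain rule for a derivation that kills `δ`. -/
theorem derivation_substAlong (D : Derivation ℝ (PowerSeries B) (PowerSeries B))
    (hD : D PowerSeries.X = 0) {X Y : PowerSeries B} (h : HasWeights X Y)
    (F : MvPowerSeries (Fin 3) ℝ) :
    D (substAlong X Y F) = substAlong X Y (MvPowerSeries.pderiv ℝ 0 F) * D X
      + substAlong X Y (MvPowerSeries.pderiv ℝ 1 F) * D Y := by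
  have hpow : ∀ N : ℕ, D ((PowerSeries.X : PowerSeries B) ^ N) = 0 := fun N => by
    rw [Derivation.leibniz_pow, hD, smul_zero, smul_zero]
  have hdvd : ∀ (N : ℕ) (z : PowerSeries B), (PowerSeries.X : PowerSeries B) ^ N ∣ z →
      (PowerSeries.X : PowerSeries B) ^ N ∣ D z := by
    rintro N _ ⟨z, rfl⟩
    rw [Derivation.leibniz, hpow, smul_zero, add_zero]
    exact dvd_mul_right _ _
  -- The defect of the chain rule is a continuous linear map in `F`. The zero submodule is closed,
  -- so it suffices that the defect vanishes on monomials.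
  have := mem_of_monomial_mem
    (D.toLinearMap ∘ₗ substLinear h
      - LinearMap.mulRight ℝ (D X) ∘ₗ substLinear h ∘ₗ (MvPowerSeries.pderiv ℝ 0).toLinearMap
      - LinearMap.mulRight ℝ (D Y) ∘ₗ substLinear h ∘ₗ (MvPowerSeries.pderiv ℝ 1).toLinearMap) ⊥
    (fun z hz => by
      refine eq_zero_of_forall_X_pow_dvd fun N => ?_
      obtain ⟨z', hz', hd⟩ := hz N
      rw [Submodule.mem_bot] at hz'
      rwa [hz', sub_zero] at hd)
    -- A partial derivative lowers the weighted order by `2` or `3`, hence the margin `3`.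
    (fun N => ⟨N + 3, fun G hG => by
      simp only [LinearMap.sub_apply, LinearMap.comp_apply, substLinear_apply,
        Derivation.coeFn_coe, LinearMap.mulRight_apply]
      refine dvd_sub (dvd_sub ?_ (dvd_mul_of_dvd_left ?_ _)) (dvd_mul_of_dvd_left ?_ _)
      · exact hdvd _ _ (X_pow_dvd_substAlong h (hG.mono (by omega)))
      · exact X_pow_dvd_substAlong h (hG.pderiv 0 (by simp [qWeight]))
      · exact X_pow_dvd_substAlong h (hG.pderiv 1 (by simp [qWeight]))⟩) F
    (fun d _ => by
      simp only [LinearMap.sub_apply, LinearMap.comp_apply, substLinear_apply,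
        Derivation.coeFn_coe, LinearMap.mulRight_apply,
        Submodule.mem_bot]
      rw [← MvPolynomial.coe_monomial, MvPowerSeries.pderiv_coe, MvPowerSeries.pderiv_coe,
        substAlong_coe, substAlong_coe, substAlong_coe]
      generalize MvPolynomial.monomial d (1 : ℝ) = p
      induction p using MvPolynomial.induction_on with
      | C c => simp
      | add p q hp hq =>
        simp only [map_add, add_mul]
        linear_combination hp + hq
      | mul_X p i hp =>
        simp only [map_mul, MvPolynomial.aeval_X, Derivation.leibniz, MvPolynomial.pderiv_X,
          smul_eq_mul, map_add]
        fin_cases i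
        · simp
          linear_combination X * hp
        · simp
          linear_combination Y * hp
        · simp [hpow]
          linear_combination (PowerSeries.X ^ 4) * hp)
  simp only [LinearMap.sub_apply, LinearMap.comp_apply, substLinear_apply,
    Derivation.coeFn_coe, LinearMap.mulRight_apply,
    Submodule.mem_bot] at this
  linear_combination this

/-- A subalgebra of series that contains `X`, `Y` and `δ ^ 4` and is closed for the order in `δ`
contains `F(X, Y, δ ^ 4)`. -/
theorem substAlong_mem {X Y : PowerSeries B} (h : HasWeights X Y)
    (S : Subalgebra ℝ (PowerSeries B))
    (hS : ∀ z, (∀ N : ℕ, ∃ z' ∈ S, (PowerSeries.X : PowerSeries B) ^ N ∣ z - z') → z ∈ S)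
    (hX : X ∈ S) (hY : Y ∈ S) (hδ : (PowerSeries.X : PowerSeries B) ^ 4 ∈ S)
    (F : MvPowerSeries (Fin 3) ℝ) : substAlong X Y F ∈ S := by
  have := mem_of_monomial_mem (substLinear h) (Subalgebra.toSubmodule S) hS
    (fun N => ⟨N, fun G hG => by simpa using X_pow_dvd_substAlong h hG⟩) F
    (fun d _ => by
      rw [substLinear_apply, substAlong_monomial]
      exact S.mul_mem (S.mul_mem (S.pow_mem hX _) (S.pow_mem hY _)) (S.pow_mem hδ _))
  simpa using this

/-- Substitution commutes with a change of coefficient algebra. -/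
theorem map_substAlong {C : Type*} [CommRing C] [Algebra ℝ C] (f : B →ₐ[ℝ] C)
    {X Y : PowerSeries B} (h : HasWeights X Y) (F : MvPowerSeries (Fin 3) ℝ) :
    PowerSeries.map (f : B →+* C) (substAlong X Y F)
      = substAlong (PowerSeries.map (f : B →+* C) X) (PowerSeries.map (f : B →+* C) Y) F := by
  have h' : HasWeights (PowerSeries.map (f : B →+* C) X) (PowerSeries.map (f : B →+* C) Y) := by
    constructor
    · simpa using map_dvd (PowerSeries.map (f : B →+* C)) h.1
    · simpa using map_dvd (PowerSeries.map (f : B →+* C)) h.2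
  ext n
  rw [PowerSeries.coeff_map, coeff_substAlong h, coeff_substAlong h']
  have hfin := MvPowerSeries.coeff_subst_finite h.hasSubst F (Finsupp.single () n)
  have hfin' : Function.HasFiniteSupport fun d : Fin 3 →₀ ℕ =>
      MvPowerSeries.coeff d F • PowerSeries.coeff n
        (X ^ d 0 * Y ^ d 1 * (PowerSeries.X ^ 4) ^ d 2) := by
    convert hfin using 3 with d
    rw [Finsupp.prod_fintype _ _ (by simp), Fin.prod_univ_three]
    rfl
  refine (map_finsum (f : B →+* C) hfin').trans (finsum_congr fun d => ?_)
  have : (f : B →+* C) (MvPowerSeries.coeff d F • PowerSeries.coeff n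
        (X ^ d 0 * Y ^ d 1 * (PowerSeries.X ^ 4) ^ d 2)) = MvPowerSeries.coeff d F •
        (f : B →+* C) (PowerSeries.coeff n (X ^ d 0 * Y ^ d 1 * (PowerSeries.X ^ 4) ^ d 2)) :=
    map_smul f _ _
  rw [this, ← PowerSeries.coeff_map]
  simp

end Substitution

/-! ### The leading part of the Hamiltonian and its gradient -/

section Hamiltonian

variable {h : MvPowerSeries (Fin 3) ℝ} {a b : ℝ}

theorem IsFormalHamiltonian.exists_remainder (hh : IsFormalHamiltonian h a b) :
    ∃ g, OrderGE 7 g ∧ h = (leadingHamiltonian a b : MvPowerSeries (Fin 3) ℝ) + g := by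
  refine ⟨h - leadingHamiltonian a b, fun d hd => ?_, by ring⟩
  rw [map_sub, MvPolynomial.coeff_coe]
  rcases Nat.lt_succ_iff_lt_or_eq.1 hd with h6 | h6
  · have hne : ∀ e : Fin 3 →₀ ℕ, Finsupp.weight qWeight e = 6 → e ≠ d := by
      rintro e he rfl
      omega
    rw [hh.order_ge d h6, zero_sub, neg_eq_zero, leadingHamiltonian, MvPolynomial.X,
      MvPolynomial.X, MvPolynomial.X, MvPolynomial.monomial_pow, MvPolynomial.monomial_pow,
      MvPolynomial.C_mul_monomial, MvPolynomial.C_mul_monomial, MvPolynomial.C_mul_monomial,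
      MvPolynomial.monomial_mul, MvPolynomial.coeff_sub, MvPolynomial.coeff_add,
      MvPolynomial.coeff_monomial, MvPolynomial.coeff_monomial, MvPolynomial.coeff_monomial,
      if_neg (hne _ ?_), if_neg (hne _ ?_), if_neg (hne _ ?_)]
    · simp
    all_goals simp [weight_qWeight]
  · rw [hh.leading d h6, sub_self]

theorem IsFormalHamiltonian.pderiv_y (hh : IsFormalHamiltonian h a b) :
    OrderGE 4 (MvPowerSeries.pderiv ℝ 1 h - (MvPolynomial.X 1 : MvPolynomial (Fin 3) ℝ)) := by
  obtain ⟨g, hg, rfl⟩ := hh.exists_remainder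
  have : MvPolynomial.pderiv 1 (leadingHamiltonian a b) = MvPolynomial.X 1 := by
    simp only [leadingHamiltonian, map_add, map_sub, Derivation.leibniz, Derivation.leibniz_pow,
      MvPolynomial.pderiv_X, MvPolynomial.pderiv_C]
    simp only [smul_eq_mul, nsmul_eq_mul, ne_eq, Fin.reduceEq, not_false_eq_true,
      Pi.single_eq_of_ne, Pi.single_eq_same, zero_ne_one]
    simp only [← mul_assoc]
    rw [show ((2 : ℕ) : MvPolynomial (Fin 3) ℝ) = MvPolynomial.C 2 from
      (map_natCast MvPolynomial.C 2).symm, ← MvPolynomial.C_mul]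
    norm_num
  rw [map_add, MvPowerSeries.pderiv_coe, this, add_sub_cancel_left]
  exact hg.pderiv 1 (by simp [qWeight])

theorem IsFormalHamiltonian.pderiv_x (hh : IsFormalHamiltonian h a b) :
    OrderGE 5 (MvPowerSeries.pderiv ℝ 0 h - (MvPolynomial.C a * MvPolynomial.X 0 ^ 2
      - MvPolynomial.C b * MvPolynomial.X 2 : MvPolynomial (Fin 3) ℝ)) := by
  obtain ⟨g, hg, rfl⟩ := hh.exists_remainder
  have : MvPolynomial.pderiv 0 (leadingHamiltonian a b) = MvPolynomial.C a * MvPolynomial.X 0 ^ 2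
      - MvPolynomial.C b * MvPolynomial.X 2 := by
    simp only [leadingHamiltonian, map_add, map_sub, Derivation.leibniz, Derivation.leibniz_pow,
      MvPolynomial.pderiv_X, MvPolynomial.pderiv_C]
    simp only [smul_eq_mul, nsmul_eq_mul, ne_eq, Fin.reduceEq, not_false_eq_true,
      Pi.single_eq_of_ne, Pi.single_eq_same, one_ne_zero]
    rw [show a = a / 3 * 3 by ring, MvPolynomial.C_mul]
    have h3 : (MvPolynomial.C 3 : MvPolynomial (Fin 3) ℝ) = 3 := map_ofNat MvPolynomial.C 3
    simp [h3]
    ring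
  rw [map_add, MvPowerSeries.pderiv_coe, this, add_sub_cancel_left]
  exact hg.pderiv 0 (by simp [qWeight])

variable {B : Type*} [CommRing B] [Algebra ℝ B]

theorem IsFormalHamiltonian.substAlong_pderiv_y (hh : IsFormalHamiltonian h a b)
    {X Y : PowerSeries B} (hXY : HasWeights X Y) :
    (PowerSeries.X : PowerSeries B) ^ 4 ∣ substAlong X Y (MvPowerSeries.pderiv ℝ 1 h) - Y := by
  have := X_pow_dvd_substAlong hXY hh.pderiv_y
  rw [substAlong_sub hXY, substAlong_coe] at this
  simpa [sub_eq_add_neg] using this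

theorem IsFormalHamiltonian.substAlong_pderiv_x (hh : IsFormalHamiltonian h a b)
    {X Y : PowerSeries B} (hXY : HasWeights X Y) :
    (PowerSeries.X : PowerSeries B) ^ 5 ∣ substAlong X Y (MvPowerSeries.pderiv ℝ 0 h)
      - (a • X ^ 2 - b • PowerSeries.X ^ 4) := by
  have := X_pow_dvd_substAlong hXY hh.pderiv_x
  rw [substAlong_sub hXY, substAlong_coe] at this
  simpa [sub_eq_add_neg, Algebra.smul_def] using this

/-- To lowest order a perturbation is felt only through the quasi-homogeneous leading part of the
gradient. The tail, of weighted order one higher, contributes one order later. This and its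
companion for `∂h/∂x` linearize the equation in every later induction. -/
theorem IsFormalHamiltonian.substAlong_pderiv_y_sub (hh : IsFormalHamiltonian h a b)
    {X Y X' Y' : PowerSeries B} (hXY : HasWeights X Y) (hXY' : HasWeights X' Y') {k : ℕ}
    (hX : (PowerSeries.X : PowerSeries B) ^ (k + 2) ∣ X' - X)
    (hY : (PowerSeries.X : PowerSeries B) ^ (k + 3) ∣ Y' - Y) :
    (PowerSeries.X : PowerSeries B) ^ (k + 4) ∣ substAlong X' Y' (MvPowerSeries.pderiv ℝ 1 h)
      - substAlong X Y (MvPowerSeries.pderiv ℝ 1 h) - (Y' - Y) := by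
  have := X_pow_dvd_substAlong_sub hXY hXY' hX hY hh.pderiv_y
  rw [substAlong_sub hXY, substAlong_sub hXY', substAlong_coe, substAlong_coe, add_comm 4 k] at this
  convert this using 1
  simp
  ring

theorem IsFormalHamiltonian.substAlong_pderiv_x_sub (hh : IsFormalHamiltonian h a b)
    {X Y X' Y' : PowerSeries B} (hXY : HasWeights X Y) (hXY' : HasWeights X' Y') {k : ℕ}
    (hX : (PowerSeries.X : PowerSeries B) ^ (k + 2) ∣ X' - X)
    (hY : (PowerSeries.X : PowerSeries B) ^ (k + 3) ∣ Y' - Y) :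
    (PowerSeries.X : PowerSeries B) ^ (k + 5) ∣ substAlong X' Y' (MvPowerSeries.pderiv ℝ 0 h)
      - substAlong X Y (MvPowerSeries.pderiv ℝ 0 h) - a • (X' ^ 2 - X ^ 2) := by
  have := X_pow_dvd_substAlong_sub hXY hXY' hX hY hh.pderiv_x
  rw [substAlong_sub hXY, substAlong_sub hXY', substAlong_coe, substAlong_coe, add_comm 5 k] at this
  convert this using 1
  simp [Algebra.smul_def]
  ring

end Hamiltonian

/-! ### Time derivative and the variable `s = tanh (t / 2)` -/

section Derivations

variable {B : Type*} [CommRing B] [Algebra ℝ B]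

/-- A derivation of the coefficient ring acts coefficient by coefficient on power series. -/
def coeffDerivation (d : Derivation ℝ B B) : Derivation ℝ (PowerSeries B) (PowerSeries B) :=
  Derivation.mk'
    { toFun := fun Z => PowerSeries.mk fun n => d (PowerSeries.coeff n Z)
      map_add' := fun Z W => by ext n; simp
      map_smul' := fun c Z => by
        ext n
        have h2 : ∀ W : PowerSeries B, PowerSeries.coeff n (c • W) = c • PowerSeries.coeff n W :=
          fun _ => rfl
        simp [h2] }
    (fun Z W => by
      ext n
      simp only [LinearMap.coe_mk, AddHom.coe_mk, PowerSeries.coeff_mk, smul_eq_mul, map_add,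
        PowerSeries.coeff_mul, map_sum, Derivation.leibniz, Finset.sum_add_distrib]
      congr 1
      rw [← Finset.Nat.sum_antidiagonal_swap]
      rfl)

@[simp]
theorem coeff_coeffDerivation (d : Derivation ℝ B B) (Z : PowerSeries B) (n : ℕ) :
    PowerSeries.coeff n (coeffDerivation d Z) = d (PowerSeries.coeff n Z) := by
  simp [coeffDerivation]

theorem coeffDerivation_X (d : Derivation ℝ B B) : coeffDerivation d PowerSeries.X = 0 := by
  ext n
  rw [coeff_coeffDerivation, PowerSeries.coeff_X]
  split_ifs <;> simp

/-- With `s = tanh (t / 2)`, the derivation `d/dt = (1 - s ^ 2) / 2 * d/ds`. -/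
def tDeriv : Derivation ℝ ℝ[X] ℝ[X] := (C (1 / 2) * (1 - X ^ 2) : ℝ[X]) • derivative'

theorem tDeriv_apply (p : ℝ[X]) : tDeriv p = C (1 / 2) * (1 - X ^ 2) * derivative p := rfl

/-- The substitution `s = tanh (t / 2)`. -/
def tanhHom : ℝ[X] →ₐ[ℝ] (ℝ → ℝ) := aeval fun t => Real.tanh (t / 2)

theorem tanhHom_apply (p : ℝ[X]) (t : ℝ) : tanhHom p t = p.eval (Real.tanh (t / 2)) := by
  induction p using Polynomial.induction_on' with
  | add p q hp hq => simp [hp, hq]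
  | monomial n c => simp [tanhHom, aeval_monomial]

theorem tanhHom_injective : Function.Injective tanhHom := by
  intro p q hpq
  refine Polynomial.eq_of_infinite_eval_eq p q ((Set.infinite_range_of_injective
    (f := fun t : ℝ => Real.tanh (t / 2)) fun t u htu => ?_).mono ?_)
  · have := Real.tanh_injective htu
    linarith
  · rintro _ ⟨t, rfl⟩
    have := congrFun hpq t
    rwa [tanhHom_apply, tanhHom_apply] at this

theorem hasDerivAt_tanh_half (t : ℝ) :
    HasDerivAt (fun t : ℝ => Real.tanh (t / 2)) (1 / 2 * (1 - Real.tanh (t / 2) ^ 2)) t := by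
  have hc := (Real.cosh_pos (t / 2)).ne'
  have h2 : HasDerivAt (fun t : ℝ => t / 2) (1 / 2) t := (hasDerivAt_id t).div_const 2
  have := (h2.sinh.div h2.cosh hc)
  refine (this.congr_of_eventuallyEq (Filter.Eventually.of_forall fun u => ?_)).congr_deriv ?_
  · exact Real.tanh_eq_sinh_div_cosh _
  · rw [Real.tanh_eq_sinh_div_cosh]
    field_simp

theorem deriv_tanhHom (p : ℝ[X]) : deriv (tanhHom p) = tanhHom (tDeriv p) := by
  funext t
  have h := (p.hasDerivAt (Real.tanh (t / 2))).comp t (hasDerivAt_tanh_half t)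
  have e : tanhHom p = (fun x => p.eval x) ∘ fun t => Real.tanh (t / 2) :=
    funext fun t => tanhHom_apply p t
  rw [e, h.deriv, tanhHom_apply, tDeriv_apply]
  simp
  ring

theorem eta0_eq : eta0 = tanhHom (1 - X ^ 2) := by
  funext t
  rw [tanhHom_apply, eta0, Real.tanh_eq_sinh_div_cosh]
  have hc := (Real.cosh_pos (t / 2)).ne'
  simp
  field_simp
  linarith [Real.cosh_sq (t / 2)]

theorem deriv_eta0_eq : deriv eta0 = tanhHom (-X * (1 - X ^ 2)) := by
  rw [eta0_eq, deriv_tanhHom, tDeriv_apply]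
  congr 1
  have h2 : (C (1 / 2) * 2 : ℝ[X]) = 1 := by
    rw [← map_ofNat C 2, ← C_mul]
    norm_num
  rw [derivative_sub, derivative_one, derivative_X_pow, Nat.cast_ofNat, map_ofNat]
  linear_combination -X * (1 - X ^ 2) * h2

theorem aeval_eta0_eq (p : ℝ[X]) : aeval eta0 p = tanhHom (p.comp (1 - X ^ 2)) := by
  rw [eta0_eq, Polynomial.aeval_algHom_apply]
  rfl

theorem timeDeriv_map (Z : PowerSeries ℝ[X]) :
    timeDeriv (PowerSeries.map (tanhHom : ℝ[X] →+* (ℝ → ℝ)) Z)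
      = PowerSeries.map (tanhHom : ℝ[X] →+* (ℝ → ℝ)) (coeffDerivation tDeriv Z) := by
  ext n : 1
  simp only [timeDeriv, PowerSeries.coeff_mk, PowerSeries.coeff_map, coeff_coeffDerivation]
  exact deriv_tanhHom _

theorem constInTime_eq (μ : PowerSeries ℝ) :
    constInTime μ = PowerSeries.map (tanhHom : ℝ[X] →+* (ℝ → ℝ)) (PowerSeries.map C μ) := by
  ext n : 1
  simp only [constInTime, PowerSeries.coeff_map]
  exact (tanhHom.commutes _).symm

end Derivations

/-! ### Orbits with coefficients polynomial in `s` -/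

/-- `X` and `Y`, series in `δ` with coefficients that are polynomials in `s = tanh (t / 2)`, solve
the equation `μ (X', Y') = J ∇ h (X, Y)`. -/
structure IsOrbit (h : MvPowerSeries (Fin 3) ℝ) (μ : PowerSeries ℝ) (X Y : PowerSeries ℝ[X]) :
    Prop where
  eq_x : PowerSeries.map C μ * coeffDerivation tDeriv X
    = substAlong X Y (MvPowerSeries.pderiv ℝ 1 h)
  eq_y : PowerSeries.map C μ * coeffDerivation tDeriv Y
    = - substAlong X Y (MvPowerSeries.pderiv ℝ 0 h)

theorem HasWeights.map {B B' : Type*} [CommRing B] [CommRing B'] (f : B →+* B')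
    {X Y : PowerSeries B} (h : HasWeights X Y) :
    HasWeights (PowerSeries.map f X) (PowerSeries.map f Y) := by
  constructor
  · simpa using map_dvd (PowerSeries.map f) h.1
  · simpa using map_dvd (PowerSeries.map f) h.2

theorem map_tanhHom_injective :
    Function.Injective (PowerSeries.map (tanhHom : ℝ[X] →+* (ℝ → ℝ))) := by
  intro Z W hZW
  ext1 n
  apply tanhHom_injective
  have := congrArg (PowerSeries.coeff n) hZW
  rwa [PowerSeries.coeff_map, PowerSeries.coeff_map] at this

/-- `tanhHom` is injective, intertwines `tDeriv` with `d/dt` and commutes with substitution, so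
nothing is lost by working over `ℝ[s]`. -/
theorem isOrbit_iff {h : MvPowerSeries (Fin 3) ℝ} {μ : PowerSeries ℝ} {X Y : PowerSeries ℝ[X]}
    (hXY : HasWeights X Y) :
    IsOrbit h μ X Y ↔
      constInTime μ * timeDeriv (PowerSeries.map (tanhHom : ℝ[X] →+* (ℝ → ℝ)) X)
        = evalAlong (PowerSeries.map (tanhHom : ℝ[X] →+* (ℝ → ℝ)) X)
          (PowerSeries.map (tanhHom : ℝ[X] →+* (ℝ → ℝ)) Y) (MvPowerSeries.pderiv ℝ 1 h) ∧
      constInTime μ * timeDeriv (PowerSeries.map (tanhHom : ℝ[X] →+* (ℝ → ℝ)) Y)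
        = - evalAlong (PowerSeries.map (tanhHom : ℝ[X] →+* (ℝ → ℝ)) X)
          (PowerSeries.map (tanhHom : ℝ[X] →+* (ℝ → ℝ)) Y) (MvPowerSeries.pderiv ℝ 0 h) := by
  have key : ∀ F, evalAlong (PowerSeries.map (tanhHom : ℝ[X] →+* (ℝ → ℝ)) X)
      (PowerSeries.map (tanhHom : ℝ[X] →+* (ℝ → ℝ)) Y) F
      = PowerSeries.map (tanhHom : ℝ[X] →+* (ℝ → ℝ)) (substAlong X Y F) :=
    fun F => (map_substAlong tanhHom hXY F).symm
  rw [timeDeriv_map, timeDeriv_map, constInTime_eq, key, key, ← map_mul, ← map_mul, ← map_neg,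
    map_tanhHom_injective.eq_iff, map_tanhHom_injective.eq_iff]
  exact ⟨fun hs => ⟨hs.1, hs.2⟩, fun hs => ⟨hs.1, hs.2⟩⟩

/-- What uniqueness needs from the prescribed form: polynomiality in `s`, the divisibility by `δ ^
2` and `δ ^ 3`, and a leading coefficient of `X` that is affine in `η₀`. -/
theorem HasFormalSeparatrix.exists_isOrbit {h : MvPowerSeries (Fin 3) ℝ} {μ : PowerSeries ℝ}
    (hμ : HasFormalSeparatrix h μ) :
    ∃ X Y : PowerSeries ℝ[X], HasWeights X Y ∧
      (∃ α β : ℝ, PowerSeries.coeff 2 X = C α + C β * (1 - Polynomial.X ^ 2)) ∧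
      ¬ (coeffDerivation tDeriv X = 0 ∧ coeffDerivation tDeriv Y = 0) ∧ IsOrbit h μ X Y := by
  obtain ⟨X, Y, ⟨X₁, X₂, Y₁, Y₂, hdeg, hX0, hXe, hXo, hY0, hYe, hYo⟩, hne, h1, h2⟩ := hμ
  -- The factor `-s (1 - s ^ 2)` is `η₀'`. For `n = 2 p + 1` the index `n / 2 - 1` is the `p - 1` of
  -- the prescribed form.
  let X' : PowerSeries ℝ[X] := PowerSeries.mk fun n => if n < 2 then 0 else
    if Even n then (X₁ (n / 2)).comp (1 - Polynomial.X ^ 2)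
    else -Polynomial.X * (1 - Polynomial.X ^ 2)
      * (X₂ (n / 2 - 1)).comp (1 - Polynomial.X ^ 2)
  let Y' : PowerSeries ℝ[X] := PowerSeries.mk fun n => if n < 3 then 0 else
    if Even n then (Y₁ (n / 2)).comp (1 - Polynomial.X ^ 2)
    else -Polynomial.X * (1 - Polynomial.X ^ 2)
      * (Y₂ (n / 2 - 1)).comp (1 - Polynomial.X ^ 2)
  have hX : PowerSeries.map (tanhHom : ℝ[X] →+* (ℝ → ℝ)) X' = X := by
    ext1 n
    rw [PowerSeries.coeff_map, PowerSeries.coeff_mk]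
    split_ifs with hn he
    · rw [hX0 n hn, map_zero]
    · obtain ⟨p, rfl⟩ := he
      rw [← two_mul, hXe p (by omega), Nat.mul_div_cancel_left _ two_pos]
      exact (aeval_eta0_eq _).symm
    · obtain ⟨p, rfl⟩ := Nat.not_even_iff_odd.1 he
      rw [hXo p (by omega), show (2 * p + 1) / 2 = p by omega, map_mul, deriv_eta0_eq,
        aeval_eta0_eq]
      rfl
  have hY : PowerSeries.map (tanhHom : ℝ[X] →+* (ℝ → ℝ)) Y' = Y := by
    ext1 n
    rw [PowerSeries.coeff_map, PowerSeries.coeff_mk]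
    split_ifs with hn he
    · rw [hY0 n hn, map_zero]
    · obtain ⟨p, rfl⟩ := he
      rw [← two_mul, hYe p (by omega), Nat.mul_div_cancel_left _ two_pos]
      exact (aeval_eta0_eq _).symm
    · obtain ⟨p, rfl⟩ := Nat.not_even_iff_odd.1 he
      rw [hYo p (by omega), show (2 * p + 1) / 2 = p by omega, map_mul, deriv_eta0_eq,
        aeval_eta0_eq]
      rfl
  have hw : HasWeights X' Y' := by
    constructor <;> rw [PowerSeries.X_pow_dvd_iff] <;> intro m hm
    · rw [PowerSeries.coeff_mk, if_pos hm]
    · rw [PowerSeries.coeff_mk, if_pos hm]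
  rw [← hX, ← hY] at h1 h2 hne
  refine ⟨X', Y', hw, ⟨(X₁ 1).coeff 0, (X₁ 1).coeff 1, ?_⟩, fun h0 => hne ?_,
    (isOrbit_iff hw).2 ⟨h1, h2⟩⟩
  · rw [PowerSeries.coeff_mk, if_neg (by norm_num), if_pos even_two]
    conv_lhs => rw [show 2 / 2 = 1 from rfl, Polynomial.eq_X_add_C_of_natDegree_le_one (hdeg 1).1]
    simp [add_comm]
  · rw [timeDeriv_map, timeDeriv_map, h0.1, h0.2, map_zero]
    exact ⟨rfl, rfl⟩

/-! ### Lowest coefficients of power series -/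

section PowerSeriesLemmas

variable {B : Type*} [CommRing B]

theorem coeff_add_mul_of_X_pow_dvd {m n : ℕ} {U V : PowerSeries B}
    (hU : (PowerSeries.X : PowerSeries B) ^ m ∣ U) (hV : (PowerSeries.X : PowerSeries B) ^ n ∣ V) :
    PowerSeries.coeff (m + n) (U * V) = PowerSeries.coeff m U * PowerSeries.coeff n V := by
  obtain ⟨u, rfl⟩ := hU
  obtain ⟨v, rfl⟩ := hV
  have e : (PowerSeries.X ^ m * u * (PowerSeries.X ^ n * v) : PowerSeries B)
      = PowerSeries.X ^ (m + n) * (u * v) := by ring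
  have h1 := PowerSeries.coeff_X_pow_mul u m 0
  have h2 := PowerSeries.coeff_X_pow_mul v n 0
  have h3 := PowerSeries.coeff_X_pow_mul (u * v) (m + n) 0
  rw [zero_add] at h1 h2 h3
  rw [e, h1, h2, h3]
  simp

theorem X_pow_succ_dvd_iff {n : ℕ} {U : PowerSeries B} :
    (PowerSeries.X : PowerSeries B) ^ (n + 1) ∣ U ↔
      (PowerSeries.X : PowerSeries B) ^ n ∣ U ∧ PowerSeries.coeff n U = 0 := by
  simp only [PowerSeries.X_pow_dvd_iff, Nat.lt_succ_iff_lt_or_eq]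
  exact ⟨fun h => ⟨fun m hm => h m (Or.inl hm), h n (Or.inr rfl)⟩,
    fun h m hm => hm.elim (h.1 m) fun e => e ▸ h.2⟩

theorem coeff_eq_of_X_pow_dvd_sub {m n : ℕ} (hmn : m < n) {U V : PowerSeries B}
    (h : (PowerSeries.X : PowerSeries B) ^ n ∣ U - V) :
    PowerSeries.coeff m U = PowerSeries.coeff m V := by
  have := PowerSeries.X_pow_dvd_iff.1 h m hmn
  rwa [map_sub, sub_eq_zero] at this

theorem X_pow_dvd_coeffDerivation [Algebra ℝ B] (d : Derivation ℝ B B) {n : ℕ} {U : PowerSeries B}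
    (h : (PowerSeries.X : PowerSeries B) ^ n ∣ U) :
    (PowerSeries.X : PowerSeries B) ^ n ∣ coeffDerivation d U := by
  rw [PowerSeries.X_pow_dvd_iff] at h ⊢
  intro m hm
  rw [coeff_coeffDerivation, h m hm, map_zero]

theorem X_pow_dvd_smul [Algebra ℝ B] (c : ℝ) {n : ℕ} {U : PowerSeries B}
    (h : (PowerSeries.X : PowerSeries B) ^ n ∣ U) :
    (PowerSeries.X : PowerSeries B) ^ n ∣ c • U := by
  rw [Algebra.smul_def]
  exact dvd_mul_of_dvd_right h _

theorem coeff_real_smul [Algebra ℝ B] (c : ℝ) (n : ℕ) (U : PowerSeries B) :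
    PowerSeries.coeff n (c • U) = c • PowerSeries.coeff n U := rfl

end PowerSeriesLemmas

theorem natDegree_tDeriv {p : ℝ[X]} (hp : p.natDegree ≠ 0) :
    (tDeriv p).natDegree = p.natDegree + 1 := by
  have hd : (derivative p).natDegree = p.natDegree - 1 := by
    rw [natDegree_derivative]
  have hd0 : derivative p ≠ 0 := fun h => hp (derivative_eq_zero.1 h)
  have hX : (1 - Polynomial.X ^ 2 : ℝ[X]).natDegree = 2 := by compute_degree!
  have hX0 : (1 - Polynomial.X ^ 2 : ℝ[X]) ≠ 0 := fun h => by simp [h] at hX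
  rw [tDeriv_apply, mul_assoc, natDegree_C_mul (by norm_num), natDegree_mul hX0 hd0, hX, hd]
  omega

/-- Two applications of `tDeriv` raise the degree of a nonconstant polynomial by two, so it cannot
be proportional to its second derivative. Constants are excluded by the value at `1`. -/
theorem eq_zero_of_tDeriv_tDeriv_eq {c e : ℝ} (he : e ≠ 0) {p : ℝ[X]}
    (hp : C c * tDeriv (tDeriv p) = C e * p) (h1 : p.eval 1 = 0) : p = 0 := by
  by_cases hdeg : p.natDegree = 0
  · rw [eq_C_of_natDegree_eq_zero hdeg, eval_C] at h1
    rw [eq_C_of_natDegree_eq_zero hdeg, h1, C_0]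
  · by_contra
    by_cases hc : c = 0
    · rw [hc, C_0, zero_mul, eq_comm, mul_eq_zero, C_eq_zero] at hp
      tauto
    · have h2 : (tDeriv p).natDegree = p.natDegree + 1 := natDegree_tDeriv hdeg
      have h3 := natDegree_tDeriv (p := tDeriv p) (by omega)
      have h4 := congrArg natDegree hp
      rw [natDegree_C_mul hc, natDegree_C_mul he] at h4
      omega

/-! ### The ends `s = ±1` of an orbit -/

/-- Evaluation at `s = c` as a homomorphism of real algebras. -/
def evalHom (c : ℝ) : ℝ[X] →ₐ[ℝ] ℝ := aeval c

@[simp]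
theorem evalHom_apply (c : ℝ) (p : ℝ[X]) : (evalHom c : ℝ[X] →+* ℝ) p = p.eval c := by
  simp [evalHom]

theorem eval_tDeriv_of_sq_eq_one {c : ℝ} (hc : c ^ 2 = 1) (p : ℝ[X]) : (tDeriv p).eval c = 0 := by
  simp [tDeriv_apply, hc]

theorem map_evalHom_tDeriv {c : ℝ} (hc : c ^ 2 = 1) (Z : PowerSeries ℝ[X]) :
    PowerSeries.map (evalHom c : ℝ[X] →+* ℝ) (coeffDerivation tDeriv Z) = 0 := by
  ext n
  rw [PowerSeries.coeff_map, coeff_coeffDerivation, evalHom_apply, eval_tDeriv_of_sq_eq_one hc,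
    map_zero]

theorem pderiv_comm (i j : Fin 3) (F : MvPowerSeries (Fin 3) ℝ) :
    MvPowerSeries.pderiv ℝ i (MvPowerSeries.pderiv ℝ j F)
      = MvPowerSeries.pderiv ℝ j (MvPowerSeries.pderiv ℝ i F) := by
  by_cases hij : i = j
  · rw [hij]
  · ext d
    simp only [MvPowerSeries.coeff_pderiv, Finsupp.add_apply, Finsupp.single_eq_of_ne hij,
      Finsupp.single_eq_of_ne (Ne.symm hij), add_zero, add_right_comm d]
    ring

/-- The derivative with respect to `s = tanh (t / 2)` at the time-infinite point `s = c`. -/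
def sDerivAt (c : ℝ) (Z : PowerSeries ℝ[X]) : PowerSeries ℝ :=
  PowerSeries.map (evalHom c : ℝ[X] →+* ℝ) (coeffDerivation derivative' Z)

theorem coeff_sDerivAt (c : ℝ) (Z : PowerSeries ℝ[X]) (n : ℕ) :
    PowerSeries.coeff n (sDerivAt c Z) = (derivative (PowerSeries.coeff n Z)).eval c := by
  rw [sDerivAt, PowerSeries.coeff_map, coeff_coeffDerivation, evalHom_apply]
  rfl

/-- At `c = ±1` the term with the second derivative carries the factor `1 - c ^ 2 = 0`, and
differentiating `(1 - s ^ 2) / 2` leaves `-c`. This is how the exponent `-c μ` of the approach to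
the equilibrium appears. -/
theorem sDerivAt_map_C_mul_tDeriv {c : ℝ} (hc : c ^ 2 = 1) (μ : PowerSeries ℝ)
    (Z : PowerSeries ℝ[X]) :
    sDerivAt c (PowerSeries.map C μ * coeffDerivation tDeriv Z) = - (c • (μ * sDerivAt c Z)) := by
  have hC : coeffDerivation derivative' (PowerSeries.map C μ) = 0 := by
    ext1 n
    rw [coeff_coeffDerivation, PowerSeries.coeff_map, map_zero]
    exact derivative_C
  have h1 : PowerSeries.map (evalHom c : ℝ[X] →+* ℝ) (PowerSeries.map C μ) = μ := by
    ext n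
    rw [PowerSeries.coeff_map, PowerSeries.coeff_map, evalHom_apply, eval_C]
  have h2 : sDerivAt c (coeffDerivation tDeriv Z) = - (c • sDerivAt c Z) := by
    ext n
    rw [map_neg, PowerSeries.coeff_smul, coeff_sDerivAt, coeff_sDerivAt, coeff_coeffDerivation,
      tDeriv_apply]
    simp [hc]
    left
    ring
  rw [sDerivAt, Derivation.leibniz, hC, smul_zero, add_zero, smul_eq_mul, map_mul, h1,
    ← sDerivAt, h2, mul_neg, mul_smul_comm]

theorem sDerivAt_substAlong (c : ℝ) {X Y : PowerSeries ℝ[X]} (h : HasWeights X Y)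
    (F : MvPowerSeries (Fin 3) ℝ) :
    sDerivAt c (substAlong X Y F) =
      substAlong (PowerSeries.map (evalHom c : ℝ[X] →+* ℝ) X)
        (PowerSeries.map (evalHom c : ℝ[X] →+* ℝ) Y) (MvPowerSeries.pderiv ℝ 0 F) * sDerivAt c X
      + substAlong (PowerSeries.map (evalHom c : ℝ[X] →+* ℝ) X)
        (PowerSeries.map (evalHom c : ℝ[X] →+* ℝ) Y) (MvPowerSeries.pderiv ℝ 1 F)
          * sDerivAt c Y := by
  rw [sDerivAt, derivation_substAlong _ (coeffDerivation_X _) h, map_add, map_mul, map_mul,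
    map_substAlong _ h, map_substAlong _ h]
  rfl

theorem sDerivAt_neg (c : ℝ) (Z : PowerSeries ℝ[X]) : sDerivAt c (-Z) = - sDerivAt c Z := by
  rw [sDerivAt, map_neg, map_neg]
  rfl

/-! ### Uniqueness of `μ` up to sign -/

section Orbits

variable {h : MvPowerSeries (Fin 3) ℝ} {a b : ℝ} {μ ν : PowerSeries ℝ} {X Y : PowerSeries ℝ[X]}

/-- `tDeriv` vanishes at `s = ±1`, so each end of the orbit is an equilibrium. -/
theorem IsOrbit.eval_eq_zero (ho : IsOrbit h μ X Y) (hXY : HasWeights X Y) {c : ℝ}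
    (hc : c ^ 2 = 1) :
    substAlong (PowerSeries.map (evalHom c : ℝ[X] →+* ℝ) X)
      (PowerSeries.map (evalHom c : ℝ[X] →+* ℝ) Y) (MvPowerSeries.pderiv ℝ 1 h) = 0 ∧
    substAlong (PowerSeries.map (evalHom c : ℝ[X] →+* ℝ) X)
      (PowerSeries.map (evalHom c : ℝ[X] →+* ℝ) Y) (MvPowerSeries.pderiv ℝ 0 h) = 0 := by
  constructor
  · rw [← map_substAlong _ hXY, ← ho.eq_x, map_mul, map_evalHom_tDeriv hc, mul_zero]
  · rw [← map_substAlong _ hXY, ← neg_eq_zero, ← map_neg, ← ho.eq_y, map_mul,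
      map_evalHom_tDeriv hc, mul_zero]

/-- An equilibrium `(X, Y)` is determined by the leading coefficient of `X`. -/
theorem equilibrium_unique (hh : IsFormalHamiltonian h a b) (ha : a ≠ 0)
    {x y x' y' : PowerSeries ℝ} (hxy : HasWeights x y) (hxy' : HasWeights x' y')
    (h1 : substAlong x y (MvPowerSeries.pderiv ℝ 1 h) = 0)
    (h0 : substAlong x y (MvPowerSeries.pderiv ℝ 0 h) = 0)
    (h1' : substAlong x' y' (MvPowerSeries.pderiv ℝ 1 h) = 0)
    (h0' : substAlong x' y' (MvPowerSeries.pderiv ℝ 0 h) = 0)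
    (hx : PowerSeries.coeff 2 x ≠ 0) (hxx' : PowerSeries.coeff 2 x' = PowerSeries.coeff 2 x) :
    x' = x ∧ y' = y := by
  have key : ∀ k : ℕ, (PowerSeries.X : PowerSeries ℝ) ^ (k + 3) ∣ x' - x ∧
      (PowerSeries.X : PowerSeries ℝ) ^ (k + 4) ∣ y' - y := by
    intro k
    induction k with
    | zero =>
      refine ⟨X_pow_succ_dvd_iff.2 ⟨dvd_sub hxy'.1 hxy.1, by rw [map_sub, hxx', sub_self]⟩, ?_⟩
      have e := hh.substAlong_pderiv_y hxy
      have e' := hh.substAlong_pderiv_y hxy'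
      rw [h1] at e
      rw [h1'] at e'
      convert dvd_sub e e' using 1
      ring
    | succ k ih =>
      have e1 := hh.substAlong_pderiv_y_sub (k := k + 1) hxy hxy' ih.1 ih.2
      have e0 := hh.substAlong_pderiv_x_sub (k := k + 1) hxy hxy' ih.1 ih.2
      rw [h1, h1', sub_zero, zero_sub, dvd_neg] at e1
      rw [h0, h0', sub_zero, zero_sub, dvd_neg] at e0
      refine ⟨X_pow_succ_dvd_iff.2 ⟨ih.1, ?_⟩, e1⟩
      -- Here `x' ^ 2 - x ^ 2 = (x' - x) (x' + x)` has lowest coefficient `2 x₂` times that of `x' -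
      -- x`, with `x₂ ≠ 0` the common leading coefficient.
      have e2 := PowerSeries.X_pow_dvd_iff.1 e0 (k + 3 + 2) (by omega)
      rw [coeff_real_smul, show x' ^ 2 - x ^ 2 = (x' - x) * (x' + x) by ring,
        coeff_add_mul_of_X_pow_dvd ih.1 (dvd_add hxy'.1 hxy.1), map_add, hxx', smul_eq_mul,
        ← two_mul] at e2
      simpa [ha, hx] using e2
  constructor
  · exact sub_eq_zero.1 (eq_zero_of_forall_X_pow_dvd fun N => (pow_dvd_pow _ (by omega)).trans
      (key N).1)
  · exact sub_eq_zero.1 (eq_zero_of_forall_X_pow_dvd fun N => (pow_dvd_pow _ (by omega)).trans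
      (key N).2)

theorem X_dvd_map_C (h0 : PowerSeries.coeff 0 μ = 0) :
    (PowerSeries.X : PowerSeries ℝ[X]) ^ 1 ∣ PowerSeries.map C μ := by
  rw [PowerSeries.X_pow_dvd_iff]
  intro m hm
  rw [Nat.lt_one_iff.1 hm, PowerSeries.coeff_map, h0, C_0]

theorem IsOrbit.coeff_y (ho : IsOrbit h μ X Y) (hh : IsFormalHamiltonian h a b)
    (hXY : HasWeights X Y) (hμ : PowerSeries.coeff 0 μ = 0) :
    PowerSeries.coeff 3 Y = C (PowerSeries.coeff 1 μ) * tDeriv (PowerSeries.coeff 2 X) := by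
  have e := coeff_eq_of_X_pow_dvd_sub (m := 3) (by norm_num) (hh.substAlong_pderiv_y hXY)
  rw [← e, ← ho.eq_x]
  exact (coeff_add_mul_of_X_pow_dvd (X_dvd_map_C hμ)
    (X_pow_dvd_coeffDerivation tDeriv hXY.1)).trans (by simp)

theorem IsOrbit.coeff_x (ho : IsOrbit h μ X Y) (hh : IsFormalHamiltonian h a b)
    (hXY : HasWeights X Y) (hμ : PowerSeries.coeff 0 μ = 0) :
    C (PowerSeries.coeff 1 μ) * tDeriv (PowerSeries.coeff 3 Y)
      = C b - C a * PowerSeries.coeff 2 X ^ 2 := by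
  have e := coeff_eq_of_X_pow_dvd_sub (m := 4) (by norm_num) (hh.substAlong_pderiv_x hXY)
  have e2 : PowerSeries.coeff (1 + 3) (PowerSeries.map C μ * coeffDerivation tDeriv Y)
      = C (PowerSeries.coeff 1 μ) * tDeriv (PowerSeries.coeff 3 Y) :=
    (coeff_add_mul_of_X_pow_dvd (X_dvd_map_C hμ)
      (X_pow_dvd_coeffDerivation tDeriv hXY.2)).trans (by simp)
  have e3 : PowerSeries.coeff (2 + 2) (X * X) = PowerSeries.coeff 2 X * PowerSeries.coeff 2 X :=
    coeff_add_mul_of_X_pow_dvd hXY.1 hXY.1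
  rw [← e2, ho.eq_y, map_neg, e, map_sub, coeff_real_smul, coeff_real_smul, sq X, e3,
    PowerSeries.coeff_X_pow, if_pos rfl, smul_eq_C_mul, smul_eq_C_mul]
  ring

/-- An orbit whose leading coefficient does not depend on time is an equilibrium. -/
theorem IsOrbit.constant (ho : IsOrbit h μ X Y) (hh : IsFormalHamiltonian h a b)
    (hXY : HasWeights X Y) (hμ : PowerSeries.coeff 0 μ = 0) (ha : a ≠ 0) {α : ℝ} (hα : α ≠ 0)
    (hX : PowerSeries.coeff 2 X = C α) :
    coeffDerivation tDeriv X = 0 ∧ coeffDerivation tDeriv Y = 0 := by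
  -- `f` freezes a polynomial at its value at `s = 1`. Thus `(X', Y')` is the equilibrium at the end
  -- of the orbit, and the aim is `X = X'`, `Y = Y'`.
  set f : ℝ[X] →ₐ[ℝ] ℝ[X] := (Algebra.ofId ℝ ℝ[X]).comp (evalHom 1) with hf
  have hfa : ∀ p, (f : ℝ[X] →+* ℝ[X]) p = C (p.eval 1) := fun p =>
    congrArg C (evalHom_apply 1 p)
  set X' := PowerSeries.map (f : ℝ[X] →+* ℝ[X]) X with hX'
  set Y' := PowerSeries.map (f : ℝ[X] →+* ℝ[X]) Y with hY'
  have hfD : ∀ Z : PowerSeries ℝ[X],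
      PowerSeries.map (f : ℝ[X] →+* ℝ[X]) (coeffDerivation tDeriv Z) = 0 := by
    intro Z
    ext1 n
    rw [PowerSeries.coeff_map, coeff_coeffDerivation, hfa,
      eval_tDeriv_of_sq_eq_one (by norm_num), C_0, map_zero]
  have hDf : ∀ Z : PowerSeries ℝ[X],
      coeffDerivation tDeriv (PowerSeries.map (f : ℝ[X] →+* ℝ[X]) Z) = 0 := by
    intro Z
    ext1 n
    rw [coeff_coeffDerivation, PowerSeries.coeff_map, hfa, tDeriv_apply, derivative_C, mul_zero,
      map_zero]
  have hXY' : HasWeights X' Y' := hXY.map _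
  have h1' : substAlong X' Y' (MvPowerSeries.pderiv ℝ 1 h) = 0 := by
    rw [hX', hY', ← map_substAlong _ hXY, ← ho.eq_x, map_mul, hfD, mul_zero]
  have h0' : substAlong X' Y' (MvPowerSeries.pderiv ℝ 0 h) = 0 := by
    rw [hX', hY', ← map_substAlong _ hXY, ← neg_eq_zero, ← map_neg, ← ho.eq_y, map_mul, hfD,
      mul_zero]
  have key : ∀ k : ℕ, (PowerSeries.X : PowerSeries ℝ[X]) ^ (k + 3) ∣ X - X' ∧
      (PowerSeries.X : PowerSeries ℝ[X]) ^ (k + 4) ∣ Y - Y' := by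
    intro k
    induction k with
    | zero =>
      have hY3 : PowerSeries.coeff 3 Y = 0 := by
        rw [ho.coeff_y hh hXY hμ, hX, tDeriv_apply, derivative_C, mul_zero, mul_zero]
      refine ⟨X_pow_succ_dvd_iff.2 ⟨dvd_sub hXY.1 hXY'.1, ?_⟩,
        X_pow_succ_dvd_iff.2 ⟨dvd_sub hXY.2 hXY'.2, ?_⟩⟩
      · rw [map_sub, PowerSeries.coeff_map, hX, hfa, eval_C, sub_self]
      · rw [map_sub, PowerSeries.coeff_map, hY3, map_zero, sub_self]
    | succ k ih =>
      have e1 := hh.substAlong_pderiv_y_sub (k := k + 1) hXY' hXY ih.1 ih.2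
      have e0 := hh.substAlong_pderiv_x_sub (k := k + 1) hXY' hXY ih.1 ih.2
      have hDX : coeffDerivation tDeriv X = coeffDerivation tDeriv (X - X') := by
        rw [map_sub, hDf, sub_zero]
      have hDY : coeffDerivation tDeriv Y = coeffDerivation tDeriv (Y - Y') := by
        rw [map_sub, hDf, sub_zero]
      rw [h1', sub_zero, ← ho.eq_x, hDX] at e1
      rw [h0', sub_zero, ← dvd_neg, neg_sub', ← ho.eq_y, hDY] at e0
      have c1 := coeff_eq_of_X_pow_dvd_sub (m := 1 + (k + 3)) (by omega) e1
      have c0 := PowerSeries.X_pow_dvd_iff.1 e0 (1 + (k + 4)) (by omega)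
      rw [coeff_add_mul_of_X_pow_dvd (X_dvd_map_C hμ) (X_pow_dvd_coeffDerivation tDeriv ih.1),
        PowerSeries.coeff_map, coeff_coeffDerivation] at c1
      have c2 : PowerSeries.coeff (k + 3 + 2) (X ^ 2 - X' ^ 2)
          = PowerSeries.coeff (k + 3) (X - X') * (C α + C α) := by
        rw [show X ^ 2 - X' ^ 2 = (X - X') * (X + X') by ring,
          coeff_add_mul_of_X_pow_dvd ih.1 (dvd_add hXY.1 hXY'.1), map_add,
          PowerSeries.coeff_map (f : ℝ[X] →+* ℝ[X]), hX, hfa, eval_C]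
      rw [map_sub, coeff_add_mul_of_X_pow_dvd (X_dvd_map_C hμ)
        (X_pow_dvd_coeffDerivation tDeriv ih.2), PowerSeries.coeff_map, coeff_coeffDerivation,
        map_neg, coeff_real_smul, show 1 + (k + 4) = k + 3 + 2 by omega, c2, smul_eq_C_mul,
        show k + 4 = 1 + (k + 3) by omega, ← c1, sub_neg_eq_add] at c0
      -- The first possible discrepancy satisfies `μ₀ ^ 2 ξ'' = -2 a α ξ` and vanishes at `s = 1`,
      -- hence is zero.
      set ξ := PowerSeries.coeff (k + 3) (X - X') with hξ
      have hξ0 : ξ = 0 := by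
        refine eq_zero_of_tDeriv_tDeriv_eq (c := (PowerSeries.coeff 1 μ) ^ 2) (e := -(2 * a * α))
          (by simp [ha, hα]) ?_ ?_
        · rw [Derivation.leibniz, tDeriv_apply (C _), derivative_C, mul_zero, smul_zero, add_zero,
            smul_eq_mul] at c0
          simp only [C_neg, C_mul, C_pow, map_ofNat]
          linear_combination c0
        · rw [hξ, map_sub, PowerSeries.coeff_map, hfa]
          simp
      refine ⟨X_pow_succ_dvd_iff.2 ⟨ih.1, hξ0⟩, X_pow_succ_dvd_iff.2 ⟨ih.2, ?_⟩⟩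
      rw [show k + 4 = 1 + (k + 3) by omega, ← c1, hξ0, map_zero, mul_zero]
  have hXX : X = X' := sub_eq_zero.1 (eq_zero_of_forall_X_pow_dvd fun N =>
    (pow_dvd_pow _ (by omega)).trans (key N).1)
  have hYY : Y = Y' := sub_eq_zero.1 (eq_zero_of_forall_X_pow_dvd fun N =>
    (pow_dvd_pow _ (by omega)).trans (key N).2)
  rw [hXX, hYY]
  exact ⟨hDf X, hDf Y⟩

/-- The leading coefficient of a nonconstant orbit. -/
theorem IsOrbit.leading (ho : IsOrbit h μ X Y) (hh : IsFormalHamiltonian h a b)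
    (hXY : HasWeights X Y) (hμ : PowerSeries.coeff 0 μ = 0) (ha : 0 < a) (hb : 0 < b) {α β : ℝ}
    (hX : PowerSeries.coeff 2 X = C α + C β * (1 - Polynomial.X ^ 2))
    (hne : ¬ (coeffDerivation tDeriv X = 0 ∧ coeffDerivation tDeriv Y = 0)) :
    α = - √(b / a) ∧ β ≠ 0 := by
  have hβ : α ≠ 0 → β ≠ 0 := by
    rintro hα rfl
    exact hne (ho.constant hh hXY hμ ha.ne' hα (by simpa using hX))
  have e := ho.coeff_x hh hXY hμ
  rw [ho.coeff_y hh hXY hμ, hX] at e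
  simp only [tDeriv_apply, derivative_mul, derivative_add, derivative_C, derivative_sub,
    derivative_one, derivative_X_pow] at e
  -- The lowest order reads `μ₀ ^ 2 x₀'' = b - a x₀ ^ 2`. The value at `s = 1` gives `a α ^ 2 = b`.
  -- The values at `0` and `1 / 2` give two expressions for `μ₀ ^ 2`, and eliminating `β` yields `2
  -- a α = -μ₀ ^ 2`, which fixes the sign of `α`.
  have e1 := congrArg (eval 1) e
  have e2 := congrArg (eval 0) e
  have e3 := congrArg (eval (1 / 2)) e
  simp at e1 e2 e3
  have hα2 : α ^ 2 = b / a := by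
    field_simp
    linarith
  have hα : α ≠ 0 := by
    rintro rfl
    have := div_pos hb ha
    norm_num at hα2
    linarith
  refine ⟨?_, hβ hα⟩
  have hb' := hβ hα
  generalize PowerSeries.coeff 1 μ = m at e2 e3
  have hb2 : b = a * α ^ 2 := by linarith
  subst hb2
  have e2' : m ^ 2 = 4 * a * α + 2 * a * β := by
    apply mul_left_cancel₀ hb'
    ring_nf at e2 ⊢
    linarith
  have e3' : m ^ 2 = 16 * a * α + 6 * a * β := by
    apply mul_left_cancel₀ hb'
    ring_nf at e3 ⊢
    linarith
  have hm : 2 * a * α = - m ^ 2 := by linarith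
  have hneg : α ≤ 0 := by
    by_contra hpos
    push Not at hpos
    have : 0 < 2 * a * α := by positivity
    nlinarith [sq_nonneg m]
  rw [← hα2, Real.sqrt_sq_eq_abs, abs_of_nonpos hneg, neg_neg]

/-- The exponent of an orbit at its equilibrium: `-μ` is an eigenvalue of the linearization, which
has trace zero. -/
theorem IsOrbit.sq_eq (ho : IsOrbit h μ X Y) (hXY : HasWeights X Y)
    {x y p q r : PowerSeries ℝ}
    (hx : x = PowerSeries.map (evalHom 1 : ℝ[X] →+* ℝ) X)
    (hy : y = PowerSeries.map (evalHom 1 : ℝ[X] →+* ℝ) Y)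
    (hp : p = substAlong x y (MvPowerSeries.pderiv ℝ 0 (MvPowerSeries.pderiv ℝ 1 h)))
    (hq : q = substAlong x y (MvPowerSeries.pderiv ℝ 1 (MvPowerSeries.pderiv ℝ 1 h)))
    (hr : r = substAlong x y (MvPowerSeries.pderiv ℝ 0 (MvPowerSeries.pderiv ℝ 0 h)))
    (hX : (derivative (PowerSeries.coeff 2 X)).eval 1 ≠ 0) :
    μ ^ 2 = p ^ 2 - q * r := by
  have e1 := congrArg (sDerivAt 1) ho.eq_x
  have e2 := congrArg (sDerivAt 1) ho.eq_y
  rw [sDerivAt_map_C_mul_tDeriv (by norm_num), one_smul, sDerivAt_substAlong 1 hXY, ← hx, ← hy,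
    ← hp, ← hq] at e1
  rw [sDerivAt_map_C_mul_tDeriv (by norm_num), one_smul, sDerivAt_neg, sDerivAt_substAlong 1 hXY,
    ← hx, ← hy, pderiv_comm 1 0, ← hp, ← hr] at e2
  have hu : sDerivAt 1 X ≠ 0 := by
    intro h0
    rw [← coeff_sDerivAt, h0, map_zero] at hX
    exact hX rfl
  -- With `u`, `v` the `s`-derivatives of `X`, `Y` at `1`, the two equations are `-μ u = p u + q v`
  -- and `μ v = r u + p v`. Eliminate `v` and cancel `u`.
  apply mul_right_cancel₀ hu
  linear_combination (p - μ) * e1 + q * e2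

/-- Both orbits end at the same equilibrium, since the leading coefficient of `X` there is `-√(b/a)`
for both. `IsOrbit.sq_eq` then expresses both squares by the same Hessian. -/
theorem eq_or_eq_neg_of_hasFormalSeparatrix (hh : IsFormalHamiltonian h a b) (ha : 0 < a)
    (hb : 0 < b) (hμ : IsOddSeries μ) (hν : IsOddSeries ν) (h1 : HasFormalSeparatrix h μ)
    (h2 : HasFormalSeparatrix h ν) : ν = μ ∨ ν = -μ := by
  obtain ⟨X, Y, hw, ⟨α, β, hX⟩, hne, ho⟩ := h1.exists_isOrbit
  obtain ⟨X', Y', hw', ⟨α', β', hX'⟩, hne', ho'⟩ := h2.exists_isOrbit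
  obtain ⟨hα, hβ⟩ := ho.leading hh hw (hμ 0) ha hb hX hne
  obtain ⟨hα', hβ'⟩ := ho'.leading hh hw' (hν 0) ha hb hX' hne'
  have hα0 : α ≠ 0 := by
    rw [hα, neg_ne_zero]
    exact (Real.sqrt_pos.2 (div_pos hb ha)).ne'
  have z := ho.eval_eq_zero hw (c := 1) (by norm_num)
  have z' := ho'.eval_eq_zero hw' (c := 1) (by norm_num)
  obtain ⟨ex, ey⟩ := equilibrium_unique hh ha.ne' (hw.map _) (hw'.map _) z.1 z.2 z'.1 z'.2
    (by rw [PowerSeries.coeff_map, hX, evalHom_apply]; simpa using hα0)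
    (by rw [PowerSeries.coeff_map, PowerSeries.coeff_map, hX, hX', evalHom_apply, evalHom_apply,
      hα, hα']; simp)
  have s := ho.sq_eq hw rfl rfl rfl rfl rfl (by rw [hX]; simpa using hβ)
  have s' := ho'.sq_eq hw' ex.symm ey.symm rfl rfl rfl (by rw [hX']; simpa using hβ')
  exact sq_eq_sq_iff_eq_or_eq_neg.1 (s'.trans s.symm)

end Orbits

/-! ### The linearized operator on polynomials in `η₀` -/

/-- The polynomial `1 - s ^ 2`, that is `η₀` in terms of `s = tanh (t / 2)`. -/
def etaPoly : ℝ[X] := 1 - X ^ 2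

theorem etaPoly_ne_zero : etaPoly ≠ 0 := fun h => by
  have := congrArg (eval 0) h
  simp [etaPoly] at this

theorem natDegree_etaPoly : etaPoly.natDegree = 2 := by
  unfold etaPoly
  compute_degree!

theorem eval_etaPoly {c : ℝ} (hc : c ^ 2 = 1) : etaPoly.eval c = 0 := by simp [etaPoly, hc]

theorem etaPoly_comp_neg : etaPoly.comp (-X) = etaPoly := by simp [etaPoly]

theorem derivative_etaPoly : derivative etaPoly = -(2 * X) := by
  simp [etaPoly]
  norm_num

theorem two_mul_C_half : (2 * C (1 / 2) : ℝ[X]) = 1 := by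
  rw [← map_ofNat C 2, ← C_mul]
  norm_num

theorem tDeriv_eq (p : ℝ[X]) : tDeriv p = C (1 / 2) * etaPoly * derivative p := rfl

theorem tDeriv_X : tDeriv X = C (1 / 2) * etaPoly := by
  rw [tDeriv_eq, derivative_X, mul_one]

theorem tDeriv_C (c : ℝ) : tDeriv (C c) = 0 := by
  rw [tDeriv_eq, derivative_C, mul_zero]

theorem tDeriv_etaPoly_pow (n : ℕ) : tDeriv (etaPoly ^ n) = -((n : ℝ[X]) * X * etaPoly ^ n) := by
  rcases n with _ | n
  · simp
  · rw [tDeriv_eq, derivative_pow, derivative_etaPoly, Nat.add_sub_cancel]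
    simp only [Nat.cast_succ, C_add, map_natCast, C_1]
    linear_combination -(((n : ℝ[X]) + 1) * X * etaPoly ^ (n + 1)) * two_mul_C_half

theorem tDeriv_etaPoly : tDeriv etaPoly = -(X * etaPoly) := by
  simpa using tDeriv_etaPoly_pow 1

/-- The operator `d²/dt² - 1 + 3 η₀`, to which the linearized equation reduces. -/
def lameOp : ℝ[X] →ₗ[ℝ] ℝ[X] :=
  tDeriv.toLinearMap ∘ₗ tDeriv.toLinearMap + LinearMap.mulLeft ℝ (3 * etaPoly - 1)

theorem lameOp_apply (p : ℝ[X]) :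
    lameOp p = tDeriv (tDeriv p) + (3 * etaPoly - 1) * p := rfl

/-- From `η₀' = -s η₀`, `s' = η₀ / 2` and `s ^ 2 = 1 - η₀`. The coefficient of the higher power
never vanishes for natural `n`, which makes it possible to solve for `η₀ ^ (n + 1)`. -/
theorem lameOp_etaPoly_pow (n : ℕ) :
    lameOp (etaPoly ^ n) = ((n : ℝ) ^ 2 - 1) • etaPoly ^ n
      - (((n : ℝ) - 3 / 2) * (n + 2)) • etaPoly ^ (n + 1) := by
  have e : (X ^ 2 : ℝ[X]) = 1 - etaPoly := by simp [etaPoly]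
  have hn : tDeriv (n : ℝ[X]) = 0 := by simp
  rw [lameOp_apply, tDeriv_etaPoly_pow, map_neg, Derivation.leibniz, Derivation.leibniz, tDeriv_X,
    tDeriv_etaPoly_pow, hn, smul_eq_C_mul, smul_eq_C_mul]
  have c3 : (C (3 / 2) : ℝ[X]) = 3 * C (1 / 2) := by
    rw [← map_ofNat C 3, ← C_mul]
    norm_num
  simp only [smul_eq_mul, C_sub, C_mul, C_add, C_pow, map_natCast, C_1, map_ofNat, c3, mul_zero,
    add_zero]
  linear_combination (n ^ 2 * etaPoly ^ n : ℝ[X]) * e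
    - ((3 + 2 * n) * etaPoly ^ (n + 1)) * two_mul_C_half

theorem tDeriv_tDeriv_etaPoly :
    tDeriv (tDeriv etaPoly) = etaPoly - (3 / 2 : ℝ) • etaPoly ^ 2 := by
  have h := lameOp_etaPoly_pow 1
  rw [lameOp_apply, pow_one, smul_eq_C_mul, smul_eq_C_mul] at h
  norm_num at h
  rw [smul_eq_C_mul]
  have c3 : (C (3 / 2) : ℝ[X]) = 3 - C (3 / 2) := by
    rw [← map_ofNat C 3, ← C_sub]
    norm_num
  linear_combination h + etaPoly ^ 2 * c3

/-- Modulo the second derivative of `η₀`, each power of `η₀` lies in the image of the linearized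
operator, without increase of the degree. -/
theorem exists_lameOp_eq_pow (n : ℕ) : ∃ P : ℝ[X], ∃ m : ℝ, P.natDegree ≤ max (n - 1) 1 ∧
    lameOp (P.comp etaPoly) = etaPoly ^ n + m • tDeriv (tDeriv etaPoly) := by
  have h0 := lameOp_etaPoly_pow 0
  have h1 := lameOp_etaPoly_pow 1
  rw [pow_zero] at h0
  rw [pow_one] at h1
  norm_num at h0 h1
  have hη : lameOp etaPoly = etaPoly - tDeriv (tDeriv etaPoly) := by
    rw [h1, tDeriv_tDeriv_etaPoly]
    abel
  induction n with
  | zero =>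
    -- Since `L 1 = 3 η₀ - 1` and `L η₀ = η₀ - η₀''`, one gets `L (3 η₀ - 1) = 1 - 3 η₀''`.
    refine ⟨C 3 * X - 1, -3, ?_, ?_⟩
    · have : (C 3 * X - 1 : ℝ[X]).natDegree ≤ 1 := by compute_degree
      exact this.trans (le_max_right _ _)
    · rw [sub_comp, mul_comp, C_comp, X_comp, one_comp, map_sub, h0, ← smul_eq_C_mul, map_smul, hη,
        pow_zero]
      module
  | succ n ih =>
    rcases n with _ | _ | n
    · refine ⟨X, -1, by simp, ?_⟩
      rw [X_comp, hη, zero_add, pow_one]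
      module
    -- `L η₀ = (3 / 2) η₀ ^ 2`, because the coefficient `n ^ 2 - 1` vanishes at `n = 1`.
    · refine ⟨C (2 / 3) * X, 0, ((natDegree_C_mul_le _ _).trans natDegree_X_le).trans (by simp), ?_⟩
      rw [mul_comp, C_comp, X_comp, ← smul_eq_C_mul, map_smul, h1, smul_smul]
      norm_num
    · obtain ⟨P, m, hP, hPm⟩ := ih
      have h2 := lameOp_etaPoly_pow (n + 2)
      set c : ℝ := (((n + 2 : ℕ) : ℝ) - 3 / 2) * ((n + 2 : ℕ) + 2) with hc
      have hc0 : c ≠ 0 := by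
        have : (0 : ℝ) ≤ n := Nat.cast_nonneg n
        rw [hc]
        push_cast
        have h3 : (0 : ℝ) < n + 2 - 3 / 2 := by linarith
        positivity
      set e : ℝ := ((n + 2 : ℕ) : ℝ) ^ 2 - 1
      clear_value c e
      change lameOp (P.comp etaPoly) = etaPoly ^ (n + 2) + _ at hPm
      -- Solve `L (η₀ ^ (n + 2)) = e η₀ ^ (n + 2) - c η₀ ^ (n + 3)` for the last power, replacing
      -- `η₀ ^ (n + 2)` by means of the induction hypothesis.
      refine ⟨C c⁻¹ * (C e * P - X ^ (n + 2)), c⁻¹ * e * m, ?_, ?_⟩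
      · have h3 : (C e * P - X ^ (n + 2)).natDegree ≤ max (n + 2) (n + 2) :=
          natDegree_sub_le_of_le ((natDegree_C_mul_le _ _).trans (hP.trans (by omega)))
            (natDegree_X_pow_le _)
        exact (natDegree_C_mul_le _ _).trans (h3.trans (by omega))
      · rw [mul_comp, sub_comp, mul_comp, C_comp, C_comp, X_pow_comp, ← smul_eq_C_mul,
          ← smul_eq_C_mul, map_smul, map_sub, map_smul, hPm, h2]
        have : etaPoly ^ (n + 1 + 1 + 1) = (c⁻¹ * c) • etaPoly ^ (n + 2 + 1) := by
          rw [inv_mul_cancel₀ hc0, one_smul]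
        conv_rhs => rw [this]
        module

theorem exists_lameOp_eq {q : ℕ} (hq : 1 ≤ q) {G : ℝ[X]} (hG : G.natDegree ≤ q + 1) :
    ∃ P : ℝ[X], ∃ m : ℝ, P.natDegree ≤ q ∧
      lameOp (P.comp etaPoly) = G.comp etaPoly + m • tDeriv (tDeriv etaPoly) := by
  choose P m hP hm using exists_lameOp_eq_pow
  refine ⟨∑ i ∈ Finset.range (q + 2), C (G.coeff i) * P i,
    ∑ i ∈ Finset.range (q + 2), G.coeff i * m i, ?_, ?_⟩
  · refine natDegree_sum_le_of_forall_le _ _ fun i hi => (natDegree_C_mul_le _ _).trans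
      ((hP i).trans ?_)
    have := Finset.mem_range.1 hi
    exact max_le (by omega) hq
  · have hsum : G.comp etaPoly
        = ∑ i ∈ Finset.range (q + 2), (monomial i (G.coeff i)).comp etaPoly := by
      rw [← Polynomial.sum_comp, ← G.as_sum_range' (q + 2) (by omega)]
    rw [hsum, Polynomial.sum_comp, map_sum, Finset.sum_smul, ← Finset.sum_add_distrib]
    refine Finset.sum_congr rfl fun i _ => ?_
    rw [mul_comp, C_comp, ← smul_eq_C_mul, map_smul, hm, monomial_comp, ← smul_eq_C_mul]
    module

/-! ### Graded polynomials in `s` -/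

/-- Polynomials in `s` of degree at most `n` and of the parity of `n` that take the same value at
`1` and `-1`. -/
structure IsGraded (n : ℕ) (p : ℝ[X]) : Prop where
  natDegree_le : p.natDegree ≤ n
  parity : p.comp (-X) = (-1) ^ n * p
  eval_eq : p.eval 1 = p.eval (-1)

theorem exists_eq_etaPoly_mul {p : ℝ[X]} (h1 : p.eval 1 = 0) (h2 : p.eval (-1) = 0) :
    ∃ u, p = etaPoly * u := by
  obtain ⟨v, rfl⟩ := dvd_iff_isRoot.2 (show p.IsRoot 1 from h1)
  have h3 : v.eval (-1) = 0 := by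
    rw [eval_mul, mul_eq_zero] at h2
    refine h2.resolve_left ?_
    simp
    norm_num
  obtain ⟨w, rfl⟩ := dvd_iff_isRoot.2 (show v.IsRoot (-1) from h3)
  refine ⟨-w, ?_⟩
  simp [etaPoly]
  ring

/-- An even polynomial minus its value at `1` vanishes at both `1` and `-1`. The quotient by
`etaPoly` is again even, of degree two less. -/
theorem exists_eq_comp_etaPoly {q : ℕ} {p : ℝ[X]} (hp : p.natDegree ≤ 2 * q)
    (he : p.comp (-X) = p) : ∃ P : ℝ[X], P.natDegree ≤ q ∧ p = P.comp etaPoly := by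
  induction q generalizing p with
  | zero =>
    refine ⟨p, hp, ?_⟩
    rw [eq_C_of_natDegree_eq_zero (Nat.le_zero.1 hp), C_comp]
  | succ q ih =>
    have hev : p.eval (-1) = p.eval 1 := by
      conv_rhs => rw [← he]
      simp
    obtain ⟨u, hu⟩ := exists_eq_etaPoly_mul (p := p - C (p.eval 1)) (by simp) (by simp [hev])
    have hudeg : u.natDegree ≤ 2 * q := by
      by_cases hu0 : u = 0
      · simp [hu0]
      · have h1 := natDegree_mul etaPoly_ne_zero hu0
        rw [← hu, natDegree_sub_C, natDegree_etaPoly] at h1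
        omega
    have hue : u.comp (-X) = u := by
      apply mul_left_cancel₀ etaPoly_ne_zero
      have h2 : (p - C (p.eval 1)).comp (-X) = (etaPoly * u).comp (-X) := by rw [hu]
      rw [sub_comp, he, C_comp, mul_comp, etaPoly_comp_neg, hu] at h2
      exact h2.symm
    obtain ⟨P, hP, rfl⟩ := ih hudeg hue
    refine ⟨C (p.eval 1) + X * P, ?_, ?_⟩
    · refine natDegree_add_le_of_degree_le (by simp) (natDegree_mul_le.trans ?_)
      rw [natDegree_X]
      omega
    · rw [add_comp, C_comp, mul_comp, X_comp, ← hu]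
      ring

theorem comp_etaPoly_comp_neg (P : ℝ[X]) : (P.comp etaPoly).comp (-X) = P.comp etaPoly := by
  rw [comp_assoc, etaPoly_comp_neg]

theorem isGraded_comp_etaPoly {q n : ℕ} (hn : n = 2 * q) {P : ℝ[X]} (hP : P.natDegree ≤ q) :
    IsGraded n (P.comp etaPoly) where
  natDegree_le := by
    rw [natDegree_comp, natDegree_etaPoly]
    omega
  parity := by rw [comp_etaPoly_comp_neg, hn, pow_mul, neg_one_sq, one_pow, one_mul]
  eval_eq := by rw [eval_comp, eval_comp, eval_etaPoly (by norm_num), eval_etaPoly (by norm_num)]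

namespace IsGraded

variable {n m : ℕ} {p q : ℝ[X]}

theorem parity_even (hp : IsGraded n p) (hn : Even n) : p.comp (-X) = p := by
  rw [hp.parity, hn.neg_one_pow, one_mul]

theorem parity_odd (hp : IsGraded n p) (hn : Odd n) : p.comp (-X) = -p := by
  rw [hp.parity, hn.neg_one_pow, neg_one_mul]

theorem eval_neg_odd (hp : IsGraded n p) (hn : Odd n) (c : ℝ) : p.eval (-c) = - p.eval c := by
  have := congrArg (eval c) (hp.parity_odd hn)
  simpa using this

theorem eval_one_odd (hp : IsGraded n p) (hn : Odd n) : p.eval 1 = 0 := by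
  have := hp.eval_neg_odd hn 1
  rw [← hp.eval_eq] at this
  linarith

theorem derivative_comp_neg (hp : IsGraded n p) :
    (derivative p).comp (-X) = -((-1) ^ n * derivative p) := by
  have := congrArg derivative hp.parity
  rw [derivative_comp, derivative_neg, derivative_X, show ((-1) ^ n : ℝ[X]) = C ((-1) ^ n) by simp,
    derivative_C_mul] at this
  rw [show ((-1) ^ n : ℝ[X]) = C ((-1) ^ n) by simp, ← this]
  ring

theorem eval_neg_derivative_odd (hp : IsGraded n p) (hn : Odd n) (c : ℝ) :
    (derivative p).eval (-c) = (derivative p).eval c := by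
  have := congrArg (eval c) hp.derivative_comp_neg
  simpa [hn.neg_one_pow] using this

theorem eval_neg_derivative_even (hp : IsGraded n p) (hn : Even n) (c : ℝ) :
    (derivative p).eval (-c) = - (derivative p).eval c := by
  have := congrArg (eval c) hp.derivative_comp_neg
  simpa [hn.neg_one_pow] using this

theorem zero (n : ℕ) : IsGraded n 0 := ⟨by simp, by simp, by simp⟩

theorem add (hp : IsGraded n p) (hq : IsGraded n q) : IsGraded n (p + q) where
  natDegree_le := natDegree_add_le_of_degree_le hp.natDegree_le hq.natDegree_le
  parity := by rw [add_comp, hp.parity, hq.parity, mul_add]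
  eval_eq := by rw [eval_add, eval_add, hp.eval_eq, hq.eval_eq]

theorem neg (hp : IsGraded n p) : IsGraded n (-p) where
  natDegree_le := by rw [natDegree_neg]; exact hp.natDegree_le
  parity := by rw [neg_comp, hp.parity, mul_neg]
  eval_eq := by rw [eval_neg, eval_neg, hp.eval_eq]

theorem mul (hp : IsGraded n p) (hq : IsGraded m q) : IsGraded (n + m) (p * q) where
  natDegree_le := natDegree_mul_le_of_le hp.natDegree_le hq.natDegree_le
  parity := by rw [mul_comp, hp.parity, hq.parity]; ring
  eval_eq := by rw [eval_mul, eval_mul, hp.eval_eq, hq.eval_eq]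

theorem C_mul (c : ℝ) (hp : IsGraded n p) : IsGraded n (C c * p) where
  natDegree_le := (natDegree_C_mul_le _ _).trans hp.natDegree_le
  parity := by rw [mul_comp, hp.parity, C_comp]; ring
  eval_eq := by rw [eval_mul, eval_mul, hp.eval_eq, eval_C, eval_C]

theorem sum {ι : Type*} (s : Finset ι) (f : ι → ℝ[X]) (h : ∀ i ∈ s, IsGraded n (f i)) :
    IsGraded n (∑ i ∈ s, f i) := by
  classical
  induction s using Finset.induction_on with
  | empty => simpa using zero n
  | insert i s hi ih =>
    rw [Finset.sum_insert hi]
    exact (h i (Finset.mem_insert_self _ _)).add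
      (ih fun j hj => h j (Finset.mem_insert_of_mem hj))

theorem tDeriv (hp : IsGraded n p) : IsGraded (n + 1) (tDeriv p) where
  natDegree_le := by
    by_cases h : p.natDegree = 0
    · rw [eq_C_of_natDegree_eq_zero h, tDeriv_C]
      simp
    · rw [natDegree_tDeriv h]
      exact Nat.succ_le_succ hp.natDegree_le
  parity := by
    rw [tDeriv_eq, mul_comp, mul_comp, C_comp, etaPoly_comp_neg, hp.derivative_comp_neg]
    ring
  eval_eq := by
    rw [eval_tDeriv_of_sq_eq_one (by norm_num), eval_tDeriv_of_sq_eq_one (by norm_num)]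

theorem of_le (hp : IsGraded n p) {k : ℕ} (hk : Even k) (hm : m = n + k) : IsGraded m p where
  natDegree_le := hp.natDegree_le.trans (by omega)
  parity := by rw [hp.parity, hm, pow_add, hk.neg_one_pow, mul_one]
  eval_eq := hp.eval_eq

theorem exists_comp_even (hp : IsGraded (2 * m) p) :
    ∃ P : ℝ[X], P.natDegree ≤ m ∧ p = P.comp etaPoly :=
  exists_eq_comp_etaPoly hp.natDegree_le (hp.parity_even (even_two_mul m))

/-- Oddness together with equal values at `±1` forces zeros at `1`, `-1` and `0`. The factor they
produce is `η₀'` up to sign, and the even quotient is a polynomial in `η₀`. -/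
theorem exists_comp_odd (hp : IsGraded (2 * m + 3) p) :
    ∃ P : ℝ[X], P.natDegree ≤ m ∧ p = -X * etaPoly * P.comp etaPoly := by
  have hodd : Odd (2 * m + 3) := ⟨m + 1, by ring⟩
  have h1 := hp.eval_one_odd hodd
  obtain ⟨u, rfl⟩ := exists_eq_etaPoly_mul h1 (by rw [← hp.eval_eq, h1])
  have h0 := hp.eval_neg_odd hodd 0
  rw [neg_zero] at h0
  have hu0 : u.eval 0 = 0 := by
    simp [etaPoly] at h0
    linarith
  obtain ⟨w, rfl⟩ := X_dvd_iff.2 (show u.coeff 0 = 0 by rwa [coeff_zero_eq_eval_zero])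
  have hw : w.comp (-X) = w := by
    have h2 := hp.parity_odd hodd
    rw [mul_comp, mul_comp, X_comp, etaPoly_comp_neg] at h2
    apply mul_left_cancel₀ (mul_ne_zero etaPoly_ne_zero (X_ne_zero (R := ℝ)))
    linear_combination -h2
  have hdeg : w.natDegree ≤ 2 * m := by
    by_cases hw0 : w = 0
    · simp [hw0]
    · have h3 := hp.natDegree_le
      rw [natDegree_mul etaPoly_ne_zero (mul_ne_zero X_ne_zero hw0), natDegree_mul X_ne_zero hw0,
        natDegree_etaPoly, natDegree_X] at h3
      omega
  obtain ⟨P, hP, hPw⟩ := exists_eq_comp_etaPoly hdeg hw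
  refine ⟨-P, by rwa [natDegree_neg], ?_⟩
  rw [neg_comp, ← hPw]
  ring

end IsGraded

/-! ### Odd right hand sides: reduction of order -/

theorem exists_antiderivative (T : ℝ[X]) {d : ℕ} (hT : T = 0 ∨ T.natDegree + 1 ≤ d) :
    ∃ z : ℝ[X], derivative z = T ∧ z.natDegree ≤ d ∧ z.eval 0 = 0 := by
  rcases hT with rfl | hT
  · exact ⟨0, by simp⟩
  refine ⟨∑ i ∈ Finset.range (T.natDegree + 1), C (T.coeff i / (i + 1)) * X ^ (i + 1), ?_, ?_, ?_⟩
  · conv_rhs => rw [T.as_sum_range_C_mul_X_pow]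
    rw [derivative_sum]
    refine Finset.sum_congr rfl fun i _ => ?_
    rw [derivative_C_mul, derivative_X_pow, Nat.add_sub_cancel, ← mul_assoc, ← C_mul]
    push_cast
    rw [div_mul_cancel₀]
    positivity
  · refine natDegree_sum_le_of_forall_le _ _ fun i hi => (natDegree_C_mul_X_pow_le _ _).trans ?_
    have := Finset.mem_range.1 hi
    omega
  · simp [eval_finsetSum]

/-- The linearized equation with an odd right hand side `g`, when the energy integral `Q` of `g`
is available. -/
theorem exists_lameOp_eq_odd {n : ℕ} (hn : Odd n) {g Q : ℝ[X]} (hg : IsGraded (n + 2) g)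
    (hg' : (derivative g).eval 1 = 0) (hQ : IsGraded (n + 4) Q)
    (hQg : tDeriv Q = tDeriv etaPoly * g) :
    ∃ ξ : ℝ[X], IsGraded n ξ ∧ lameOp ξ = g := by
  have hn2 : Odd (n + 2) := hn.add_even even_two
  have hn4 : Odd (n + 4) := hn.add_even ⟨2, rfl⟩
  have hm1 : ((-1 : ℝ)) ^ 2 = 1 := by norm_num
  have hdQ : derivative Q = -(2 * X * g) := by
    rw [tDeriv_eq, tDeriv_etaPoly] at hQg
    apply mul_left_cancel₀ etaPoly_ne_zero
    linear_combination 2 * hQg - etaPoly * derivative Q * two_mul_C_half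
  -- `etaPoly ^ 2` divides `g`
  obtain ⟨g₁, hg₁⟩ := exists_eq_etaPoly_mul (hg.eval_one_odd hn2)
    (by rw [← hg.eval_eq, hg.eval_one_odd hn2])
  have hroot : ∀ c : ℝ, c ^ 2 = 1 → (derivative g).eval c = 0 → g₁.eval c = 0 := by
    intro c hc h
    rw [hg₁, derivative_mul, derivative_etaPoly] at h
    simp [eval_etaPoly hc] at h
    rcases h with h | h
    · rw [h] at hc
      norm_num at hc
    · exact h
  obtain ⟨g₂, hg₂⟩ := exists_eq_etaPoly_mul (hroot 1 (by norm_num) hg')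
    (hroot (-1) hm1 (by rw [hg.eval_neg_derivative_odd hn2, hg']))
  -- `etaPoly ^ 3` divides `Q`
  have hstep : ∀ (j : ℕ) (u w : ℝ[X]), derivative (etaPoly ^ (j + 1) * u) = etaPoly ^ (j + 1) * w →
      ∃ v, u = etaPoly * v := by
    intro j u w h
    have h2 : 2 * ((j + 1 : ℕ) : ℝ[X]) * X * u = etaPoly * (derivative u - w) := by
      rw [derivative_mul, derivative_pow, derivative_etaPoly, Nat.add_sub_cancel] at h
      apply mul_left_cancel₀ (pow_ne_zero j etaPoly_ne_zero)
      rw [map_natCast] at h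
      linear_combination -h
    have h3 : ∀ c : ℝ, c ^ 2 = 1 → u.eval c = 0 := by
      intro c hc
      have h4 := congrArg (eval c) h2
      have hj : (j : ℝ) + 1 ≠ 0 := by positivity
      have hc0 : c ≠ 0 := by
        rintro rfl
        norm_num at hc
      simpa [eval_etaPoly hc, hj, hc0] using h4
    exact exists_eq_etaPoly_mul (h3 1 (by norm_num)) (h3 (-1) hm1)
  obtain ⟨Q₁, hQ₁⟩ := exists_eq_etaPoly_mul (hQ.eval_one_odd hn4)
    (by rw [← hQ.eval_eq, hQ.eval_one_odd hn4])
  obtain ⟨Q₂, hQ₂⟩ := hstep 0 Q₁ (-(2 * X * etaPoly * g₂)) (by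
    rw [zero_add, pow_one, ← hQ₁, hdQ, hg₁, hg₂]
    ring)
  obtain ⟨Q₃, hQ₃⟩ := hstep 1 Q₂ (-(2 * X * g₂)) (by
    rw [show etaPoly ^ (1 + 1) * Q₂ = Q by rw [hQ₁, hQ₂]; ring, hdQ, hg₁, hg₂]
    ring)
  -- `X ^ 2` divides `Q`
  have hX : ∀ p : ℝ[X], p.eval 0 = 0 → ∃ u, p = X * u := fun p hp =>
    X_dvd_iff.2 (by rwa [coeff_zero_eq_eval_zero])
  have hQ0 : Q.eval 0 = 0 := by
    have := hQ.eval_neg_odd hn4 0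
    rw [neg_zero] at this
    linarith
  obtain ⟨R₁, hR₁⟩ := hX Q hQ0
  obtain ⟨R₂, hR₂⟩ := hX R₁ (by
    have := congrArg (eval 0) hdQ
    rw [hR₁, derivative_mul] at this
    simpa using this)
  have hcop : IsCoprime (X ^ 2 : ℝ[X]) (etaPoly ^ 3) :=
    IsCoprime.pow ⟨X, 1, by simp [etaPoly]; ring⟩
  obtain ⟨T, hT⟩ := hcop.mul_dvd ⟨R₂, by rw [hR₁, hR₂]; ring⟩
    ⟨Q₃, show Q = etaPoly ^ 3 * Q₃ by rw [hQ₁, hQ₂, hQ₃]; ring⟩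
  have hne : (X ^ 2 * etaPoly ^ 3 : ℝ[X]) ≠ 0 :=
    mul_ne_zero (pow_ne_zero 2 X_ne_zero) (pow_ne_zero 3 etaPoly_ne_zero)
  have hTodd : T.comp (-X) = -T := by
    have := hQ.parity_odd hn4
    rw [hT, mul_comp, mul_comp, X_pow_comp, pow_comp, etaPoly_comp_neg] at this
    apply mul_left_cancel₀ hne
    linear_combination this
  -- The divisor `X ^ 2 * etaPoly ^ 3` has degree `8`, so `T ≠ 0` forces `n ≥ 4` and the truncated
  -- `n - 3` is harmless.
  have hTdeg : 2 * -T = 0 ∨ (2 * -T).natDegree + 1 ≤ n - 3 := by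
    by_cases hT0 : T = 0
    · exact Or.inl (by rw [hT0, neg_zero, mul_zero])
    · right
      have h1 := hQ.natDegree_le
      rw [hT, natDegree_mul hne hT0, natDegree_mul (pow_ne_zero 2 X_ne_zero)
        (pow_ne_zero 3 etaPoly_ne_zero), natDegree_pow, natDegree_pow, natDegree_etaPoly,
        natDegree_X] at h1
      have h2 : (2 * -T).natDegree = T.natDegree := by
        rw [← map_ofNat C 2, natDegree_C_mul (by norm_num), natDegree_neg]
      omega
  -- Reduction of order: put `ξ = v z` with `v = s η₀ = -η₀'`. The equation becomes `(v ^ 2 z')' = v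
  -- g = -Q'`, and `v ^ 2 z' = -Q` means `dz/ds = -2 T`.
  obtain ⟨z, hz, hzdeg, hz0⟩ := exists_antiderivative (2 * -T) hTdeg
  have hzeven : z.comp (-X) = z := by
    have h1 : derivative (z.comp (-X) - z) = 0 := by
      rw [derivative_sub, derivative_comp, hz, derivative_neg, derivative_X, mul_comp, neg_comp, hTodd]
      simp
    have h2 := eq_C_of_natDegree_eq_zero (derivative_eq_zero.1 h1)
    rw [coeff_zero_eq_eval_zero] at h2
    simp [hz0] at h2
    exact sub_eq_zero.1 h2
  have hDz : tDeriv z = -(etaPoly * T) := by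
    rw [tDeriv_eq, hz]
    linear_combination -(etaPoly * T) * two_mul_C_half
  refine ⟨X * etaPoly * z, ⟨?_, ?_, ?_⟩, ?_⟩
  · by_cases hz1 : z = 0
    · simp [hz1]
    · by_cases hn3 : 3 ≤ n
      · rw [natDegree_mul (mul_ne_zero X_ne_zero etaPoly_ne_zero) hz1,
          natDegree_mul X_ne_zero etaPoly_ne_zero, natDegree_etaPoly, natDegree_X]
        omega
      · have h3 : z.natDegree = 0 := by omega
        rw [eq_C_of_natDegree_eq_zero h3, eval_C] at hz0
        rw [eq_C_of_natDegree_eq_zero h3, hz0] at hz1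
        simp at hz1
  · rw [mul_comp, mul_comp, X_comp, etaPoly_comp_neg, hzeven, hn.neg_one_pow]
    ring
  · simp [eval_etaPoly]
  · have hv : tDeriv (X * etaPoly) = C (1 / 2) * etaPoly ^ 2 - X ^ 2 * etaPoly := by
      rw [Derivation.leibniz, tDeriv_etaPoly, tDeriv_X]
      simp only [smul_eq_mul]
      ring
    -- Invariance under time translation: `η₀'` solves the homogeneous linearized equation.
    have hL : lameOp (X * etaPoly) = 0 := by
      have h3 := tDeriv_tDeriv_etaPoly
      rw [lameOp_apply, hv, map_sub, Derivation.leibniz, tDeriv_C, tDeriv_etaPoly_pow,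
        Derivation.leibniz, tDeriv_etaPoly, Derivation.leibniz_pow, tDeriv_X]
      simp only [smul_eq_mul, nsmul_eq_mul, add_zero, Nat.cast_ofNat, pow_one,
        mul_zero, Nat.reduceSub]
      have e : (X ^ 2 : ℝ[X]) = 1 - etaPoly := by simp [etaPoly]
      linear_combination X * etaPoly * e - 2 * (X * etaPoly ^ 2) * two_mul_C_half
    have hvne : (X * etaPoly : ℝ[X]) ≠ 0 := mul_ne_zero X_ne_zero etaPoly_ne_zero
    apply mul_left_cancel₀ hvne
    have hD : tDeriv ((X * etaPoly) ^ 2 * tDeriv z) = X * etaPoly * g := by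
      rw [show (X * etaPoly) ^ 2 * tDeriv z = -Q by rw [hDz, hT]; ring, map_neg, hQg, tDeriv_etaPoly]
      ring
    have hvz : X * etaPoly * lameOp (X * etaPoly * z)
        = tDeriv ((X * etaPoly) ^ 2 * tDeriv z) + X * etaPoly * z * lameOp (X * etaPoly) := by
      generalize X * etaPoly = v
      rw [lameOp_apply, lameOp_apply]
      simp only [Derivation.leibniz, Derivation.leibniz_pow, map_add, smul_eq_mul, nsmul_eq_mul,
        Nat.cast_ofNat, Nat.reduceSub, pow_one]
      ring
    rw [hvz, hL, hD, mul_zero, add_zero]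

/-! ### Graded series, approximate orbits and their correction -/

/-- Series in `δ` whose coefficient of `δ ^ n` is a graded polynomial of order `n`. -/
def gradedSeries : Subalgebra ℝ (PowerSeries ℝ[X]) where
  carrier := {Z | ∀ n, IsGraded n (PowerSeries.coeff n Z)}
  mul_mem' := fun {Z W} hZ hW n => by
    rw [PowerSeries.coeff_mul]
    refine IsGraded.sum _ _ fun ij hij => ?_
    rw [← Finset.HasAntidiagonal.mem_antidiagonal.1 hij]
    exact (hZ _).mul (hW _)
  add_mem' := fun {Z W} hZ hW n => by
    rw [map_add]
    exact (hZ n).add (hW n)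
  algebraMap_mem' := fun c n => by
    rw [PowerSeries.algebraMap_apply, PowerSeries.coeff_C]
    split_ifs with hn
    · subst hn
      exact ⟨(natDegree_C c).le, by rw [pow_zero, one_mul]; exact C_comp,
        (eval_C (a := c)).trans eval_C.symm⟩
    · exact IsGraded.zero n

theorem mem_gradedSeries_of_approx (Z : PowerSeries ℝ[X])
    (h : ∀ N : ℕ, ∃ Z' ∈ gradedSeries, (PowerSeries.X : PowerSeries ℝ[X]) ^ N ∣ Z - Z') :
    Z ∈ gradedSeries := by
  intro n
  obtain ⟨Z', hZ', hd⟩ := h (n + 1)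
  rw [coeff_eq_of_X_pow_dvd_sub (Nat.lt_succ_self n) hd]
  exact hZ' n

theorem monomial_mem_gradedSeries {n : ℕ} {p : ℝ[X]} (hp : IsGraded n p) :
    PowerSeries.monomial n p ∈ gradedSeries := by
  intro m
  rw [PowerSeries.coeff_monomial]
  split_ifs with hm
  · rwa [hm]
  · exact IsGraded.zero m

theorem isGraded_one_of_even {n : ℕ} (hn : Even n) : IsGraded n 1 :=
  ⟨by simp, by rw [hn.neg_one_pow, one_comp, one_mul], by simp⟩

theorem substAlong_mem_gradedSeries {X Y : PowerSeries ℝ[X]} (h : HasWeights X Y)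
    (hX : X ∈ gradedSeries) (hY : Y ∈ gradedSeries) (F : MvPowerSeries (Fin 3) ℝ) :
    substAlong X Y F ∈ gradedSeries := by
  refine substAlong_mem h _ mem_gradedSeries_of_approx hX hY ?_ F
  rw [PowerSeries.X_pow_eq]
  exact monomial_mem_gradedSeries (isGraded_one_of_even ⟨2, rfl⟩)

/-- `tDeriv` raises the grade by one and `μ` contains only odd powers `δ ^ (2 l + 1)`. The remaining
shift `2 l` is even, so the parity is respected. -/
theorem mul_tDeriv_mem_gradedSeries {μ : PowerSeries ℝ} (hμ : IsOddSeries μ)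
    {Z : PowerSeries ℝ[X]} (hZ : Z ∈ gradedSeries) :
    PowerSeries.map C μ * coeffDerivation tDeriv Z ∈ gradedSeries := by
  intro n
  rw [PowerSeries.coeff_mul]
  refine IsGraded.sum _ _ fun ij hij => ?_
  rw [PowerSeries.coeff_map, coeff_coeffDerivation]
  have hij' := Finset.HasAntidiagonal.mem_antidiagonal.1 hij
  rcases Nat.even_or_odd' ij.1 with ⟨l, hl | hl⟩
  · rw [hl, hμ, C_0, zero_mul]
    exact IsGraded.zero n
  · exact ((hZ ij.2).tDeriv.of_le (even_two_mul l) (by omega)).C_mul _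

/-- The defect of `μ X' = ∂h/∂y`. -/
def residualX (h : MvPowerSeries (Fin 3) ℝ) (μ : PowerSeries ℝ) (X Y : PowerSeries ℝ[X]) :
    PowerSeries ℝ[X] :=
  PowerSeries.map C μ * coeffDerivation tDeriv X - substAlong X Y (MvPowerSeries.pderiv ℝ 1 h)

/-- The defect of `μ Y' = -∂h/∂x`. -/
def residualY (h : MvPowerSeries (Fin 3) ℝ) (μ : PowerSeries ℝ) (X Y : PowerSeries ℝ[X]) :
    PowerSeries ℝ[X] :=
  PowerSeries.map C μ * coeffDerivation tDeriv Y + substAlong X Y (MvPowerSeries.pderiv ℝ 0 h)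

/-- The leading coefficient of `X` on the separatrix whose equilibrium is `-κ`. -/
def leadingX (κ : ℝ) : ℝ[X] := C (-κ) + C (3 * κ) * etaPoly

theorem tDeriv_leadingX (κ : ℝ) : tDeriv (leadingX κ) = C (3 * κ) * tDeriv etaPoly := by
  rw [leadingX, map_add, tDeriv_C, zero_add, Derivation.leibniz, tDeriv_C, smul_zero, add_zero,
    smul_eq_mul]

/-- `(X, Y)` solves the equation up to relative order `δ ^ k`. -/
structure IsApproxOrbit (h : MvPowerSeries (Fin 3) ℝ) (κ m₀ : ℝ) (k : ℕ) (μ : PowerSeries ℝ)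
    (X Y : PowerSeries ℝ[X]) : Prop where
  odd : IsOddSeries μ
  coeff_one : PowerSeries.coeff 1 μ = m₀
  weights : HasWeights X Y
  mem_x : X ∈ gradedSeries
  mem_y : Y ∈ gradedSeries
  coeff_two : PowerSeries.coeff 2 X = leadingX κ
  coeff_three : PowerSeries.coeff 3 Y = C m₀ * tDeriv (leadingX κ)
  dvd_x : (PowerSeries.X : PowerSeries ℝ[X]) ^ (k + 3) ∣ residualX h μ X Y
  dvd_y : (PowerSeries.X : PowerSeries ℝ[X]) ^ (k + 4) ∣ residualY h μ X Y

theorem X_pow_dvd_monomial {B : Type*} [CommRing B] (n : ℕ) (p : B) :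
    (PowerSeries.X : PowerSeries B) ^ n ∣ PowerSeries.monomial n p := by
  rw [PowerSeries.X_pow_dvd_iff]
  intro m hm
  rw [PowerSeries.coeff_monomial, if_neg hm.ne]

theorem map_monomial {B B' : Type*} [CommRing B] [CommRing B'] (f : B →+* B') (n : ℕ) (p : B) :
    PowerSeries.map f (PowerSeries.monomial n p) = PowerSeries.monomial n (f p) := by
  ext m
  rw [PowerSeries.coeff_map, PowerSeries.coeff_monomial, PowerSeries.coeff_monomial]
  split_ifs <;> simp

namespace IsApproxOrbit

variable {h : MvPowerSeries (Fin 3) ℝ} {a b κ m₀ : ℝ} {k : ℕ} {μ : PowerSeries ℝ}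
  {X Y : PowerSeries ℝ[X]}

theorem isGraded_residualX (ho : IsApproxOrbit h κ m₀ k μ X Y) (n : ℕ) :
    IsGraded n (PowerSeries.coeff n (residualX h μ X Y)) :=
  gradedSeries.sub_mem (mul_tDeriv_mem_gradedSeries ho.odd ho.mem_x)
    (substAlong_mem_gradedSeries ho.weights ho.mem_x ho.mem_y _) n

theorem isGraded_residualY (ho : IsApproxOrbit h κ m₀ k μ X Y) (n : ℕ) :
    IsGraded n (PowerSeries.coeff n (residualY h μ X Y)) :=
  gradedSeries.add_mem (mul_tDeriv_mem_gradedSeries ho.odd ho.mem_y)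
    (substAlong_mem_gradedSeries ho.weights ho.mem_x ho.mem_y _) n

/-- A correction of relative order `δ ^ k` raises the order of the approximation when it solves the
linearized equation. -/
theorem correct (ho : IsApproxOrbit h κ m₀ k μ X Y) (hh : IsFormalHamiltonian h a b)
    (hk : 1 ≤ k) {ξ θ : ℝ[X]} {m : ℝ} (hm : Odd k → m = 0) (hξ : IsGraded (k + 2) ξ)
    (hθ : IsGraded (k + 3) θ)
    (h1 : PowerSeries.coeff (k + 3) (residualX h μ X Y) + C m₀ * tDeriv ξ
      + C m * tDeriv (leadingX κ) = θ)
    (h2 : PowerSeries.coeff (k + 4) (residualY h μ X Y) + C m₀ * tDeriv θ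
      + C m * tDeriv (C m₀ * tDeriv (leadingX κ)) + C (2 * a) * leadingX κ * ξ = 0) :
    IsApproxOrbit h κ m₀ (k + 1) (μ + PowerSeries.monomial (k + 1) m)
      (X + PowerSeries.monomial (k + 2) ξ) (Y + PowerSeries.monomial (k + 3) θ) := by
  have hXd := X_pow_dvd_monomial (k + 2) ξ
  have hYd := X_pow_dvd_monomial (k + 3) θ
  have hμd := X_pow_dvd_monomial (k + 1) (C m : ℝ[X])
  set ΔX := PowerSeries.monomial (k + 2) ξ with hΔX
  set ΔY := PowerSeries.monomial (k + 3) θ with hΔY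
  have hμ1 : (PowerSeries.X : PowerSeries ℝ[X]) ^ 1 ∣ PowerSeries.map C μ :=
    X_dvd_map_C (ho.odd 0)
  have hw : HasWeights (X + ΔX) (Y + ΔY) :=
    ⟨dvd_add ho.weights.1 ((pow_dvd_pow _ (by omega)).trans hXd),
      dvd_add ho.weights.2 ((pow_dvd_pow _ (by omega)).trans hYd)⟩
  have c2 : PowerSeries.coeff 2 (X + ΔX) = leadingX κ := by
    rw [map_add, ho.coeff_two, hΔX, PowerSeries.coeff_monomial, if_neg (by omega), add_zero]
  have c3 : PowerSeries.coeff 3 (Y + ΔY) = C m₀ * tDeriv (leadingX κ) := by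
    rw [map_add, ho.coeff_three, hΔY, PowerSeries.coeff_monomial, if_neg (by omega), add_zero]
  have p1 := hh.substAlong_pderiv_y_sub ho.weights hw (k := k) (by simpa using hXd)
    (by simpa using hYd)
  have p0 := hh.substAlong_pderiv_x_sub ho.weights hw (k := k) (by simpa using hXd)
    (by simpa using hYd)
  rw [add_sub_cancel_left] at p1
  -- The new defect is arranged as explicit terms of order `k + 3`, whose lowest coefficient is
  -- cancelled by `h1`, plus a remainder controlled by `p1`. The next identity does the same one
  -- order higher with `h2` and `p0`.
  have eX : residualX h (μ + PowerSeries.monomial (k + 1) m) (X + ΔX) (Y + ΔY)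
      = residualX h μ X Y + PowerSeries.map C μ * coeffDerivation tDeriv ΔX
        + PowerSeries.monomial (k + 1) (C m) * coeffDerivation tDeriv (X + ΔX) - ΔY
        - (substAlong (X + ΔX) (Y + ΔY) (MvPowerSeries.pderiv ℝ 1 h)
          - substAlong X Y (MvPowerSeries.pderiv ℝ 1 h) - ΔY) := by
    rw [residualX, residualX, map_add, map_monomial, map_add]
    ring
  have eY : residualY h (μ + PowerSeries.monomial (k + 1) m) (X + ΔX) (Y + ΔY)
      = residualY h μ X Y + PowerSeries.map C μ * coeffDerivation tDeriv ΔY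
        + PowerSeries.monomial (k + 1) (C m) * coeffDerivation tDeriv (Y + ΔY)
        + a • (ΔX * (X + X + ΔX))
        + (substAlong (X + ΔX) (Y + ΔY) (MvPowerSeries.pderiv ℝ 0 h)
          - substAlong X Y (MvPowerSeries.pderiv ℝ 0 h) - a • ((X + ΔX) ^ 2 - X ^ 2)) := by
    rw [residualY, residualY, map_add, map_monomial, map_add,
      show (X + ΔX) ^ 2 - X ^ 2 = ΔX * (X + X + ΔX) by ring]
    ring
  have hDX := X_pow_dvd_coeffDerivation tDeriv hXd
  have hDY := X_pow_dvd_coeffDerivation tDeriv hYd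
  have hDX' := X_pow_dvd_coeffDerivation tDeriv hw.1
  have hDY' := X_pow_dvd_coeffDerivation tDeriv hw.2
  have hXX : (PowerSeries.X : PowerSeries ℝ[X]) ^ 2 ∣ X + X + ΔX := by
    rw [add_assoc]
    exact dvd_add ho.weights.1 hw.1
  have t1 := coeff_add_mul_of_X_pow_dvd hμ1 hDX
  have t2 := coeff_add_mul_of_X_pow_dvd hμd hDX'
  have t3 := coeff_add_mul_of_X_pow_dvd hμ1 hDY
  have t4 := coeff_add_mul_of_X_pow_dvd hμd hDY'
  have t5 := coeff_add_mul_of_X_pow_dvd hXd hXX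
  have cX : PowerSeries.coeff (k + 2) ΔX = ξ := by
    rw [hΔX, PowerSeries.coeff_monomial, if_pos rfl]
  have cY : PowerSeries.coeff (k + 3) ΔY = θ := by
    rw [hΔY, PowerSeries.coeff_monomial, if_pos rfl]
  have cμ : PowerSeries.coeff (k + 1) (PowerSeries.monomial (k + 1) (C m : ℝ[X])) = C m := by
    rw [PowerSeries.coeff_monomial, if_pos rfl]
  have cXX : PowerSeries.coeff 2 (X + X + ΔX) = leadingX κ + leadingX κ := by
    rw [add_assoc, map_add, ho.coeff_two, c2]
  rw [PowerSeries.coeff_map, coeff_coeffDerivation, ho.coeff_one] at t1 t3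
  rw [coeff_coeffDerivation, cμ] at t2 t4
  rw [cX] at t1
  rw [c2] at t2
  rw [cY] at t3
  rw [c3] at t4
  rw [cX, cXX] at t5
  refine ⟨fun j => ?_, ?_, hw, gradedSeries.add_mem ho.mem_x (monomial_mem_gradedSeries hξ),
    gradedSeries.add_mem ho.mem_y (monomial_mem_gradedSeries hθ), c2, c3, ?_, ?_⟩
  · rw [map_add, ho.odd, zero_add, PowerSeries.coeff_monomial]
    split_ifs with hj
    -- An even exponent `k + 1 = 2 j` means that `k` is odd, where `m = 0` keeps `μ` odd.
    · exact hm ⟨j - 1, by omega⟩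
    · rfl
  · rw [map_add, ho.coeff_one, PowerSeries.coeff_monomial, if_neg (by omega), add_zero]
  · rw [eX, show k + 1 + 3 = k + 4 by ring]
    refine dvd_sub (X_pow_succ_dvd_iff.2 ⟨?_, ?_⟩) p1
    · refine dvd_sub (dvd_add (dvd_add ho.dvd_x ?_) ?_) hYd
      · rw [show k + 3 = 1 + (k + 2) by ring, pow_add]
        exact mul_dvd_mul hμ1 hDX
      · rw [show k + 3 = k + 1 + 2 by ring, pow_add]
        exact mul_dvd_mul hμd hDX'
    · rw [show 1 + (k + 2) = k + 3 by ring] at t1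
      rw [map_sub, map_add, map_add, t1, t2, cY, h1, sub_self]
  · rw [eY, show k + 1 + 4 = k + 5 by ring]
    refine dvd_add (X_pow_succ_dvd_iff.2 ⟨?_, ?_⟩) p0
    · refine dvd_add (dvd_add (dvd_add ho.dvd_y ?_) ?_) (X_pow_dvd_smul _ ?_)
      · rw [show k + 4 = 1 + (k + 3) by ring, pow_add]
        exact mul_dvd_mul hμ1 hDY
      · rw [show k + 4 = k + 1 + 3 by ring, pow_add]
        exact mul_dvd_mul hμd hDY'
      · rw [show k + 4 = k + 2 + 2 by ring, pow_add]
        exact mul_dvd_mul hXd hXX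
    · rw [show 1 + (k + 3) = k + 4 by ring] at t3
      rw [map_add, map_add, map_add, coeff_real_smul, t3, t4, t5, smul_eq_C_mul, ← h2, C_mul,
        map_ofNat]
      ring

/-- The energy integral of the leading residuals. -/
theorem tDeriv_energy (ho : IsApproxOrbit h κ m₀ k μ X Y) :
    tDeriv (PowerSeries.coeff (k + 6) (substAlong X Y h)
        + PowerSeries.coeff (k + 3) (residualX h μ X Y) * (C m₀ * tDeriv (leadingX κ)))
      = tDeriv (leadingX κ) * (PowerSeries.coeff (k + 4) (residualY h μ X Y)
        + C m₀ * tDeriv (PowerSeries.coeff (k + 3) (residualX h μ X Y))) := by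
  -- The rate of change of `h` along the curve. The two terms `μ X' Y'` cancel, so an exact orbit
  -- would conserve `h`.
  have e : coeffDerivation tDeriv (substAlong X Y h)
      = residualY h μ X Y * coeffDerivation tDeriv X
        - residualX h μ X Y * coeffDerivation tDeriv Y := by
    rw [derivation_substAlong _ (coeffDerivation_X _) ho.weights, residualX, residualY]
    ring
  have e' := congrArg (PowerSeries.coeff (k + 6)) e
  have t1 := coeff_add_mul_of_X_pow_dvd ho.dvd_y (X_pow_dvd_coeffDerivation tDeriv ho.weights.1)
  have t2 := coeff_add_mul_of_X_pow_dvd ho.dvd_x (X_pow_dvd_coeffDerivation tDeriv ho.weights.2)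
  rw [coeff_coeffDerivation, ho.coeff_two] at t1
  rw [coeff_coeffDerivation, ho.coeff_three] at t2
  rw [map_sub, coeff_coeffDerivation] at e'
  rw [show k + 4 + 2 = k + 6 by ring] at t1
  rw [show k + 3 + 3 = k + 6 by ring] at t2
  rw [t1, t2] at e'
  rw [map_add, e', Derivation.leibniz (D := tDeriv) (a := PowerSeries.coeff (k + 3) _)]
  simp only [smul_eq_mul]
  ring

theorem map_evalHom_eq {Z : PowerSeries ℝ[X]} (hZ : Z ∈ gradedSeries) :
    PowerSeries.map (evalHom (-1) : ℝ[X] →+* ℝ) Z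
      = PowerSeries.map (evalHom 1 : ℝ[X] →+* ℝ) Z := by
  ext n
  rw [PowerSeries.coeff_map, PowerSeries.coeff_map, evalHom_apply, evalHom_apply,
    (hZ n).eval_eq]

theorem sDerivAt_residualX (ho : IsApproxOrbit h κ m₀ k μ X Y) {c : ℝ} (hc : c ^ 2 = 1) :
    sDerivAt c (residualX h μ X Y) = - (c • (μ * sDerivAt c X))
      - (substAlong (PowerSeries.map (evalHom c : ℝ[X] →+* ℝ) X)
        (PowerSeries.map (evalHom c : ℝ[X] →+* ℝ) Y)
          (MvPowerSeries.pderiv ℝ 0 (MvPowerSeries.pderiv ℝ 1 h)) * sDerivAt c X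
      + substAlong (PowerSeries.map (evalHom c : ℝ[X] →+* ℝ) X)
        (PowerSeries.map (evalHom c : ℝ[X] →+* ℝ) Y)
          (MvPowerSeries.pderiv ℝ 1 (MvPowerSeries.pderiv ℝ 1 h)) * sDerivAt c Y) := by
  rw [← sDerivAt_substAlong c ho.weights, ← sDerivAt_map_C_mul_tDeriv hc, residualX, sDerivAt,
    map_sub, map_sub]
  rfl

theorem sDerivAt_residualY (ho : IsApproxOrbit h κ m₀ k μ X Y) {c : ℝ} (hc : c ^ 2 = 1) :
    sDerivAt c (residualY h μ X Y) = - (c • (μ * sDerivAt c Y))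
      + (substAlong (PowerSeries.map (evalHom c : ℝ[X] →+* ℝ) X)
        (PowerSeries.map (evalHom c : ℝ[X] →+* ℝ) Y)
          (MvPowerSeries.pderiv ℝ 0 (MvPowerSeries.pderiv ℝ 0 h)) * sDerivAt c X
      + substAlong (PowerSeries.map (evalHom c : ℝ[X] →+* ℝ) X)
        (PowerSeries.map (evalHom c : ℝ[X] →+* ℝ) Y)
          (MvPowerSeries.pderiv ℝ 0 (MvPowerSeries.pderiv ℝ 1 h)) * sDerivAt c Y) := by
  rw [pderiv_comm 0 1, ← sDerivAt_substAlong c ho.weights, ← sDerivAt_map_C_mul_tDeriv hc,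
    residualY, sDerivAt, map_add, map_add]
  rfl

theorem X_pow_dvd_sDerivAt (c : ℝ) {n : ℕ} {U : PowerSeries ℝ[X]}
    (hU : (PowerSeries.X : PowerSeries ℝ[X]) ^ n ∣ U) :
    (PowerSeries.X : PowerSeries ℝ) ^ n ∣ sDerivAt c U := by
  rw [PowerSeries.X_pow_dvd_iff] at hU ⊢
  intro m hm
  rw [coeff_sDerivAt, hU m hm, derivative_zero, eval_zero]

/-- The linearizations of the residuals at the two ends of the orbit are related by the symplectic
form, since both ends are at the same equilibrium. -/
theorem wronskian (ho : IsApproxOrbit h κ m₀ k μ X Y) :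
    sDerivAt 1 (residualX h μ X Y) * sDerivAt (-1) Y
        - sDerivAt 1 (residualY h μ X Y) * sDerivAt (-1) X
      = sDerivAt (-1) (residualX h μ X Y) * sDerivAt 1 Y
        - sDerivAt (-1) (residualY h μ X Y) * sDerivAt 1 X := by
  rw [ho.sDerivAt_residualX (c := 1) (by norm_num), ho.sDerivAt_residualY (c := 1) (by norm_num),
    ho.sDerivAt_residualX (c := -1) (by norm_num), ho.sDerivAt_residualY (c := -1) (by norm_num),
    map_evalHom_eq ho.mem_x, map_evalHom_eq ho.mem_y]
  simp only [one_smul, neg_smul, neg_neg]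
  ring

/-- Read off the coefficient of `δ ^ (k + 6)` in `wronskian`. For odd `k`, parity expresses the data
at `s = -1` through those at `s = 1` in such a way that the two sides are opposite, so both vanish.
Up to a nonzero factor, either side is the derivative in question. -/
theorem eval_derivative_eq_zero (ho : IsApproxOrbit h κ m₀ k μ X Y) (hk : Odd k) (hκ : κ ≠ 0) :
    (derivative (PowerSeries.coeff (k + 4) (residualY h μ X Y)
        + C m₀ * tDeriv (PowerSeries.coeff (k + 3) (residualX h μ X Y)))).eval 1 = 0 := by
  have hY := ho.isGraded_residualY (k + 4)
  have hX := ho.isGraded_residualX (k + 3)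
  have e := congrArg (PowerSeries.coeff (k + 6)) ho.wronskian
  have t := fun c d : ℝ => coeff_add_mul_of_X_pow_dvd (X_pow_dvd_sDerivAt c ho.dvd_x)
    (X_pow_dvd_sDerivAt d ho.weights.2)
  have u := fun c d : ℝ => coeff_add_mul_of_X_pow_dvd (X_pow_dvd_sDerivAt c ho.dvd_y)
    (X_pow_dvd_sDerivAt d ho.weights.1)
  simp only [coeff_sDerivAt, ho.coeff_two, ho.coeff_three] at t u
  rw [map_sub, map_sub] at e
  simp only [show k + 3 + 3 = k + 6 by ring] at t u
  rw [t, t, u, u, hY.eval_neg_derivative_odd (hk.add_even ⟨2, rfl⟩),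
    hX.eval_neg_derivative_even (hk.add_odd ⟨1, rfl⟩)] at e
  have hDD : ∀ p : ℝ[X], ∀ c : ℝ, c ^ 2 = 1 →
      (derivative (tDeriv p)).eval c = - c * (derivative p).eval c := by
    intro p c hc
    rw [tDeriv_eq, derivative_mul, derivative_mul, derivative_etaPoly]
    simp [eval_etaPoly hc]
  have hx : derivative (leadingX κ) = -(C (6 * κ) * Polynomial.X) := by
    rw [leadingX, derivative_add, derivative_C, derivative_C_mul, derivative_etaPoly,
      show (6 * κ) = 2 * (3 * κ) by ring, C_mul (a := 2), map_ofNat]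
    ring
  rw [derivative_C_mul, eval_C_mul, eval_C_mul, hDD _ 1 (by norm_num), hDD _ (-1) (by norm_num),
    hx] at e
  rw [derivative_add, derivative_C_mul, eval_add, eval_C_mul, hDD _ 1 (by norm_num)]
  simp at e
  apply mul_left_cancel₀ (mul_ne_zero (by norm_num : (12 : ℝ) ≠ 0) hκ)
  linarith

/-- Eliminating `θ` from the two conditions of `correct` leaves one equation for `lameOp ξ`. For
even `k` the number `m` absorbs the obstruction. For odd `k` one takes `m = 0`, and solvability
comes from `tDeriv_energy` and `eval_derivative_eq_zero`. -/
theorem exists_succ (ho : IsApproxOrbit h κ m₀ k μ X Y) (hh : IsFormalHamiltonian h a b)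
    (hk : 1 ≤ k) (hκ : 0 < κ) (hm₀ : 0 < m₀) (hm : m₀ ^ 2 = 2 * a * κ) :
    ∃ μ' X' Y', IsApproxOrbit h κ m₀ (k + 1) μ' X' Y' ∧
      (PowerSeries.X : PowerSeries ℝ) ^ (k + 1) ∣ μ' - μ ∧
      (PowerSeries.X : PowerSeries ℝ[X]) ^ (k + 2) ∣ X' - X ∧
      (PowerSeries.X : PowerSeries ℝ[X]) ^ (k + 3) ∣ Y' - Y := by
  have hY := ho.isGraded_residualY (k + 4)
  have hX := ho.isGraded_residualX (k + 3)
  have hH := substAlong_mem_gradedSeries ho.weights ho.mem_x ho.mem_y h (k + 6)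
  have hy := ho.mem_y 3
  have hD := ho.tDeriv_energy
  have hE := fun hk => ho.eval_derivative_eq_zero hk hκ.ne'
  rw [ho.coeff_three] at hy
  set ρ := PowerSeries.coeff (k + 3) (residualX h μ X Y) with hρ
  set τ := PowerSeries.coeff (k + 4) (residualY h μ X Y) with hτ
  have hg : IsGraded (k + 4) (τ + C m₀ * tDeriv ρ) := hY.add (hX.tDeriv.C_mul m₀)
  have hx0 : IsGraded 2 (leadingX κ) := by
    rw [← ho.coeff_two]
    exact ho.mem_x 2
  have hm0 : m₀ ≠ 0 := hm₀.ne'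
  have hmC : (C m₀ ^ 2 * C (m₀ ^ 2)⁻¹ : ℝ[X]) = 1 := by
    rw [← C_pow, ← C_mul, mul_inv_cancel₀ (pow_ne_zero 2 hm0), C_1]
  -- The choice `m₀ ^ 2 = 2 a κ` makes the linearized operator `m₀ ^ 2` times `lameOp`.
  have hax : C (2 * a) * leadingX κ = C m₀ ^ 2 * (3 * etaPoly - 1) := by
    have h3 : (C (3 * κ) : ℝ[X]) = 3 * C κ := by rw [C_mul, map_ofNat]
    have h4 : (C (2 * a) * C κ : ℝ[X]) = C m₀ ^ 2 := by rw [← C_mul, ← C_pow, hm]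
    rw [leadingX, h3, C_neg]
    linear_combination (3 * etaPoly - 1) * h4
  have key : ∃ (ξ : ℝ[X]) (m : ℝ), IsGraded (k + 2) ξ ∧ (Odd k → m = 0) ∧
      lameOp ξ = -(C (m₀ ^ 2)⁻¹ * ((τ + C m₀ * tDeriv ρ)
        + C (2 * m₀ * m) * tDeriv (tDeriv (leadingX κ)))) := by
    rcases Nat.even_or_odd' k with ⟨j, hj | hj⟩
    · have hG : IsGraded (2 * (j + 2)) (-(C (m₀ ^ 2)⁻¹ * (τ + C m₀ * tDeriv ρ))) := by
        have := (hg.C_mul (m₀ ^ 2)⁻¹).neg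
        rwa [hj, show 2 * j + 4 = 2 * (j + 2) by ring] at this
      obtain ⟨G, hGdeg, hGeq⟩ := hG.exists_comp_even
      obtain ⟨P, n, hP, hPn⟩ := exists_lameOp_eq (q := j + 1) (by omega) hGdeg
      -- As `x₀'' = 3 κ η₀''`, this `m` is the solution of `2 m₀ m * 3 κ / m₀ ^ 2 = -n`, where `n`
      -- is the multiple of `η₀''` left over.
      refine ⟨P.comp etaPoly, -(m₀ * n) / (6 * κ), isGraded_comp_etaPoly (by omega) hP,
        fun hodd => ?_, ?_⟩
      · rw [hj] at hodd
        exact absurd hodd (Nat.not_odd_iff_even.2 (even_two_mul j))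
      · have hc : (C (m₀ ^ 2)⁻¹ * (C (2 * m₀ * (-(m₀ * n) / (6 * κ))) * C (3 * κ)) : ℝ[X])
            = - C n := by
          rw [← C_mul, ← C_mul, ← C_neg]
          congr 1
          field_simp
          ring
        rw [hPn, ← hGeq, tDeriv_leadingX, Derivation.leibniz, tDeriv_C, smul_eq_C_mul]
        simp only [smul_eq_mul, mul_zero, add_zero]
        linear_combination tDeriv (tDeriv etaPoly) * hc
    · have hodd : Odd k := ⟨j, hj⟩
      -- The energy integral, rescaled: `tDeriv_energy` has the factor `x₀' = 3 κ η₀'` where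
      -- `exists_lameOp_eq_odd` expects `η₀'`, and the right hand side is divided by `-m₀ ^ 2`.
      have hQ : IsGraded (k + 2 + 4) (-(C (m₀ ^ 2)⁻¹ * (C (3 * κ)⁻¹ *
          (PowerSeries.coeff (k + 6) (substAlong X Y h) + ρ * (C m₀ * tDeriv (leadingX κ)))))) :=
        ((((hH.add (hX.mul hy))).C_mul _).C_mul _).neg
      have hκC : (C (3 * κ)⁻¹ * C (3 * κ) : ℝ[X]) = 1 := by
        rw [← C_mul, inv_mul_cancel₀ (by positivity), C_1]
      obtain ⟨ξ, hξ, hLξ⟩ := exists_lameOp_eq_odd (hodd.add_even even_two)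
        (g := -(C (m₀ ^ 2)⁻¹ * (τ + C m₀ * tDeriv ρ))) (hg.C_mul _).neg
        (by rw [derivative_neg, derivative_C_mul, eval_neg, eval_C_mul, hE hodd, mul_zero,
          neg_zero]) hQ (by
          rw [map_neg, ← smul_eq_C_mul, Derivation.map_smul, ← smul_eq_C_mul (3 * κ)⁻¹,
            Derivation.map_smul, hD,
            tDeriv_leadingX, smul_eq_C_mul, smul_eq_C_mul]
          linear_combination (-C (m₀ ^ 2)⁻¹ * tDeriv etaPoly * (τ + C m₀ * tDeriv ρ)) * hκC)
      refine ⟨ξ, 0, hξ, fun _ => rfl, ?_⟩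
      rw [hLξ, mul_zero, C_0, zero_mul, add_zero]
  obtain ⟨ξ, m, hξ, hmk, hL⟩ := key
  have hmx : IsGraded (k + 3) (C m * tDeriv (leadingX κ)) := by
    rcases Nat.even_or_odd k with he | hodd
    · exact (hx0.tDeriv.of_le he (by omega)).C_mul m
    · rw [hmk hodd, C_0, zero_mul]
      exact IsGraded.zero _
  refine ⟨_, _, _, ho.correct hh hk hmk hξ ((hX.add (hξ.tDeriv.C_mul m₀)).add hmx) rfl ?_, ?_, ?_,
    ?_⟩
  · rw [hax]
    rw [lameOp_apply] at hL
    simp only [map_add, Derivation.leibniz, tDeriv_C, smul_eq_mul, mul_zero, add_zero]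
    have h2 : (C (2 * m₀ * m) : ℝ[X]) = 2 * C m₀ * C m := by rw [C_mul, C_mul, map_ofNat]
    rw [h2] at hL
    linear_combination C m₀ ^ 2 * hL - (τ + C m₀ * tDeriv ρ
      + 2 * C m₀ * C m * tDeriv (tDeriv (leadingX κ))) * hmC
  · rw [add_sub_cancel_left]
    exact X_pow_dvd_monomial _ _
  · rw [add_sub_cancel_left]
    exact X_pow_dvd_monomial _ _
  · rw [add_sub_cancel_left]
    exact X_pow_dvd_monomial _ _

end IsApproxOrbit

/-! ### Passage to the limit and existence -/

theorem exists_X_adic_limit {B : Type*} [CommRing B] {c : ℕ} (Z : ℕ → PowerSeries B)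
    (hZ : ∀ k, (PowerSeries.X : PowerSeries B) ^ (k + c) ∣ Z (k + 1) - Z k) :
    ∃ L, ∀ k, (PowerSeries.X : PowerSeries B) ^ (k + c) ∣ L - Z k := by
  have hstab : ∀ k j, (PowerSeries.X : PowerSeries B) ^ (k + c) ∣ Z (k + j) - Z k := by
    intro k j
    induction j with
    | zero => simp
    | succ j ih =>
      rw [← sub_add_sub_cancel _ (Z (k + j))]
      exact dvd_add ((pow_dvd_pow _ (by omega)).trans (hZ (k + j))) ih
  refine ⟨PowerSeries.mk fun n => PowerSeries.coeff n (Z (n + 1)), fun k => ?_⟩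
  rw [PowerSeries.X_pow_dvd_iff]
  intro m hm
  rw [map_sub, PowerSeries.coeff_mk, sub_eq_zero]
  have e1 := coeff_eq_of_X_pow_dvd_sub hm (hstab k (m + 1))
  have e2 := coeff_eq_of_X_pow_dvd_sub (m := m) (by omega) (hstab (m + 1) k)
  rw [← e1, ← e2, add_comm]

theorem isGraded_leadingX (κ : ℝ) : IsGraded 2 (leadingX κ) := by
  have : leadingX κ = (C (-κ) + C (3 * κ) * X).comp etaPoly := by
    simp [leadingX]
  rw [this]
  refine isGraded_comp_etaPoly (q := 1) rfl ?_
  compute_degree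

section Existence

variable {h : MvPowerSeries (Fin 3) ℝ} {a b κ m₀ : ℝ}

/-- With `η₀'' = η₀ - (3 / 2) η₀ ^ 2`, both sides of `m₀ ^ 2 x₀'' = b - a x₀ ^ 2` equal `6 a κ ^ 2
η₀ - 9 a κ ^ 2 η₀ ^ 2`. Only the tail of `h` contributes to the defects. -/
theorem isApproxOrbit_one (hh : IsFormalHamiltonian h a b) (hb : b = a * κ ^ 2)
    (hm : m₀ ^ 2 = 2 * a * κ) :
    IsApproxOrbit h κ m₀ 1 (PowerSeries.monomial 1 m₀) (PowerSeries.monomial 2 (leadingX κ))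
      (PowerSeries.monomial 3 (C m₀ * tDeriv (leadingX κ))) := by
  have hw : HasWeights (PowerSeries.monomial 2 (leadingX κ))
      (PowerSeries.monomial 3 (C m₀ * tDeriv (leadingX κ))) :=
    ⟨X_pow_dvd_monomial _ _, X_pow_dvd_monomial _ _⟩
  have hD : ∀ (n : ℕ) (p : ℝ[X]), PowerSeries.map C (PowerSeries.monomial 1 m₀)
      * coeffDerivation tDeriv (PowerSeries.monomial n p)
      = PowerSeries.monomial (1 + n) (C m₀ * tDeriv p) := by
    intro n p
    have : coeffDerivation tDeriv (PowerSeries.monomial n p) = PowerSeries.monomial n (tDeriv p) := by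
      ext1 j
      rw [coeff_coeffDerivation, PowerSeries.coeff_monomial, PowerSeries.coeff_monomial]
      split_ifs <;> simp
    rw [map_monomial, this, PowerSeries.monomial_mul_monomial]
  refine ⟨fun k => ?_, ?_, hw, monomial_mem_gradedSeries (isGraded_leadingX κ),
    monomial_mem_gradedSeries ((isGraded_leadingX κ).tDeriv.C_mul m₀), ?_, ?_, ?_, ?_⟩
  · rw [PowerSeries.coeff_monomial, if_neg (by omega)]
  · rw [PowerSeries.coeff_monomial, if_pos rfl]
  · rw [PowerSeries.coeff_monomial, if_pos rfl]
  · rw [PowerSeries.coeff_monomial, if_pos rfl]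
  · rw [residualX, hD, ← dvd_neg, neg_sub]
    exact hh.substAlong_pderiv_y hw
  · have e : PowerSeries.map C (PowerSeries.monomial 1 m₀) * coeffDerivation tDeriv
        (PowerSeries.monomial 3 (C m₀ * tDeriv (leadingX κ)))
        = -(a • (PowerSeries.monomial 2 (leadingX κ)) ^ 2 - b • PowerSeries.X ^ 4) := by
      rw [hD, sq, PowerSeries.monomial_mul_monomial]
      ext1 n
      rw [map_neg, map_sub, coeff_real_smul, coeff_real_smul, PowerSeries.coeff_monomial,
        PowerSeries.coeff_monomial, PowerSeries.coeff_X_pow]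
      by_cases hn : n = 4
      · rw [if_pos (by omega), if_pos (by omega), if_pos hn]
        have h3 : (C (3 / 2) : ℝ[X]) = 3 * C (1 / 2) := by
          rw [← map_ofNat C 3, ← C_mul]
          norm_num
        have h4 : (C m₀ ^ 2 : ℝ[X]) = 2 * C a * C κ := by
          rw [← C_pow, hm, C_mul, C_mul, map_ofNat]
        rw [Derivation.leibniz, tDeriv_C, tDeriv_leadingX, Derivation.leibniz, tDeriv_C,
          tDeriv_tDeriv_etaPoly, leadingX, hb]
        simp only [smul_eq_C_mul, smul_eq_mul, h3, mul_zero, add_zero, C_mul, C_neg, C_pow,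
          map_ofNat, mul_one]
        linear_combination (3 * C κ * (etaPoly - 3 * C (1 / 2) * etaPoly ^ 2)) * h4
          - 9 * C a * C κ ^ 2 * etaPoly ^ 2 * two_mul_C_half
      · rw [if_neg (by omega), if_neg (by omega), if_neg hn]
        simp
    rw [residualY, e, neg_add_eq_sub]
    exact hh.substAlong_pderiv_x hw

/-- The formal separatrix as a series in `δ` over the polynomials in `tanh (t / 2)`. -/
theorem exists_isOrbit (hh : IsFormalHamiltonian h a b) (hb : b = a * κ ^ 2)
    (hκ : 0 < κ) (hm₀ : 0 < m₀) (hm : m₀ ^ 2 = 2 * a * κ) :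
    ∃ μ X Y, IsOddSeries μ ∧ PowerSeries.coeff 1 μ = m₀ ∧ HasWeights X Y ∧ X ∈ gradedSeries ∧
      Y ∈ gradedSeries ∧ PowerSeries.coeff 2 X = leadingX κ ∧ IsOrbit h μ X Y := by
  let St : ℕ → Type := fun k => {p : PowerSeries ℝ × PowerSeries ℝ[X] × PowerSeries ℝ[X] //
    IsApproxOrbit h κ m₀ (k + 1) p.1 p.2.1 p.2.2}
  have hnext : ∀ (k : ℕ) (s : St k), ∃ s' : St (k + 1),
      (PowerSeries.X : PowerSeries ℝ) ^ (k + 2) ∣ s'.1.1 - s.1.1 ∧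
      (PowerSeries.X : PowerSeries ℝ[X]) ^ (k + 3) ∣ s'.1.2.1 - s.1.2.1 ∧
      (PowerSeries.X : PowerSeries ℝ[X]) ^ (k + 4) ∣ s'.1.2.2 - s.1.2.2 := by
    rintro k ⟨p, hp⟩
    obtain ⟨μ', X', Y', ho, h1, h2, h3⟩ := hp.exists_succ hh (by omega) hκ hm₀ hm
    exact ⟨⟨(μ', X', Y'), ho⟩, h1, h2, h3⟩
  choose next h1 h2 h3 using hnext
  let s₀ : St 0 := ⟨(_, _, _), isApproxOrbit_one hh hb hm⟩
  let s : ∀ k, St k := fun k => Nat.rec s₀ next k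
  obtain ⟨μ, hμ⟩ := exists_X_adic_limit (fun k => (s k).1.1) (fun k => h1 k (s k))
  obtain ⟨X, hX⟩ := exists_X_adic_limit (fun k => (s k).1.2.1) (fun k => h2 k (s k))
  obtain ⟨Y, hY⟩ := exists_X_adic_limit (fun k => (s k).1.2.2) (fun k => h3 k (s k))
  have hs := fun k => (s k).2
  have hw : HasWeights X Y := by
    constructor
    · exact (dvd_sub_left (hs 0).weights.1).1 ((pow_dvd_pow _ (by omega)).trans (hX 0))
    · exact (dvd_sub_left (hs 0).weights.2).1 ((pow_dvd_pow _ (by omega)).trans (hY 0))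
  have hodd : IsOddSeries μ := fun j => by
    rw [coeff_eq_of_X_pow_dvd_sub (by omega) (hμ (2 * j))]
    exact (hs _).odd j
  have hμd : ∀ k, (PowerSeries.X : PowerSeries ℝ[X]) ^ (k + 2) ∣
      PowerSeries.map C μ - PowerSeries.map C (s k).1.1 := by
    intro k
    have := map_dvd (PowerSeries.map (C : ℝ →+* ℝ[X])) (hμ k)
    simpa using this
  have hmul : ∀ (k : ℕ) (Z Z' : PowerSeries ℝ[X]) (w : ℕ),
      (PowerSeries.X : PowerSeries ℝ[X]) ^ w ∣ Z →
      (PowerSeries.X : PowerSeries ℝ[X]) ^ (k + 1 + w) ∣ Z - Z' →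
      (PowerSeries.X : PowerSeries ℝ[X]) ^ (k + 2 + w) ∣
        PowerSeries.map C μ * coeffDerivation tDeriv Z
          - PowerSeries.map C (s k).1.1 * coeffDerivation tDeriv Z' := by
    intro k Z Z' w hZ hZZ
    have e : PowerSeries.map C μ * coeffDerivation tDeriv Z
          - PowerSeries.map C (s k).1.1 * coeffDerivation tDeriv Z'
        = (PowerSeries.map C μ - PowerSeries.map C (s k).1.1) * coeffDerivation tDeriv Z
          + PowerSeries.map C (s k).1.1 * coeffDerivation tDeriv (Z - Z') := by
      rw [map_sub]
      ring
    rw [e]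
    refine dvd_add ?_ ?_
    · rw [pow_add]
      exact mul_dvd_mul (hμd k) (X_pow_dvd_coeffDerivation _ hZ)
    · rw [show k + 2 + w = 1 + (k + 1 + w) by ring, pow_add]
      exact mul_dvd_mul (X_dvd_map_C ((hs k).odd 0)) (X_pow_dvd_coeffDerivation _ hZZ)
  have hX' : ∀ k, (PowerSeries.X : PowerSeries ℝ[X]) ^ (k + 1 + 2) ∣ X - (s k).1.2.1 := hX
  have hY' : ∀ k, (PowerSeries.X : PowerSeries ℝ[X]) ^ (k + 1 + 3) ∣ Y - (s k).1.2.2 := hY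
  -- The defect of the limit differs from that of the `k`-th approximation by `O(δ ^ (k + 4))`, the
  -- order to which the latter already vanishes.
  have hrx : residualX h μ X Y = 0 := by
    refine eq_zero_of_forall_X_pow_dvd fun k => (pow_dvd_pow _ (by omega : k ≤ k + 4)).trans ?_
    have e : residualX h μ X Y = residualX h (s k).1.1 (s k).1.2.1 (s k).1.2.2
        + (PowerSeries.map C μ * coeffDerivation tDeriv X
          - PowerSeries.map C (s k).1.1 * coeffDerivation tDeriv (s k).1.2.1)
        - (substAlong X Y (MvPowerSeries.pderiv ℝ 1 h)
          - substAlong (s k).1.2.1 (s k).1.2.2 (MvPowerSeries.pderiv ℝ 1 h)) := by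
      rw [residualX, residualX]
      ring
    rw [e]
    refine dvd_sub (dvd_add (hs k).dvd_x (hmul k _ _ 2 hw.1 (hX' k))) ?_
    rw [show k + 4 = 3 + (k + 1) by ring]
    exact X_pow_dvd_substAlong_sub (hs k).weights hw (hX' k) (hY' k)
      (OrderGE.pderiv (w := 6) hh.order_ge 1 (by simp [qWeight]))
  have hry : residualY h μ X Y = 0 := by
    refine eq_zero_of_forall_X_pow_dvd fun k => (pow_dvd_pow _ (by omega : k ≤ k + 5)).trans ?_
    have e : residualY h μ X Y = residualY h (s k).1.1 (s k).1.2.1 (s k).1.2.2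
        + (PowerSeries.map C μ * coeffDerivation tDeriv Y
          - PowerSeries.map C (s k).1.1 * coeffDerivation tDeriv (s k).1.2.2)
        + (substAlong X Y (MvPowerSeries.pderiv ℝ 0 h)
          - substAlong (s k).1.2.1 (s k).1.2.2 (MvPowerSeries.pderiv ℝ 0 h)) := by
      rw [residualY, residualY]
      ring
    rw [e]
    refine dvd_add (dvd_add (hs k).dvd_y (hmul k _ _ 3 hw.2 (hY' k))) ?_
    rw [show k + 5 = 4 + (k + 1) by ring]
    exact X_pow_dvd_substAlong_sub (hs k).weights hw (hX' k) (hY' k)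
      (OrderGE.pderiv (w := 6) hh.order_ge 0 (by simp [qWeight]))
  refine ⟨μ, X, Y, hodd, ?_, hw, fun n => ?_, fun n => ?_, ?_, ⟨sub_eq_zero.1 hrx,
    eq_neg_of_add_eq_zero_left hry⟩⟩
  · rw [coeff_eq_of_X_pow_dvd_sub (by omega) (hμ 0)]
    exact (hs 0).coeff_one
  · rw [coeff_eq_of_X_pow_dvd_sub (by omega) (hX n)]
    exact (hs n).mem_x n
  · rw [coeff_eq_of_X_pow_dvd_sub (by omega) (hY n)]
    exact (hs n).mem_y n
  · rw [coeff_eq_of_X_pow_dvd_sub (by omega) (hX 0)]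
    exact (hs 0).coeff_two

/-- Even grades are polynomials in `η₀`, odd grades at least `3` are `η₀'` times such polynomials,
and the degree bounds follow from the grade. -/
theorem hasSeparatrixForm_map {X Y : PowerSeries ℝ[X]} (hw : HasWeights X Y)
    (hX : X ∈ gradedSeries) (hY : Y ∈ gradedSeries) :
    HasSeparatrixForm (PowerSeries.map (tanhHom : ℝ[X] →+* (ℝ → ℝ)) X)
      (PowerSeries.map (tanhHom : ℝ[X] →+* (ℝ → ℝ)) Y) := by
  choose X₁ hX₁ eX₁ using fun p : ℕ => (hX (2 * p)).exists_comp_even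
  choose X₂ hX₂ eX₂ using fun p : ℕ => (hX (2 * p + 3)).exists_comp_odd
  choose Y₁ hY₁ eY₁ using fun p : ℕ => (hY (2 * p)).exists_comp_even
  choose Y₂ hY₂ eY₂ using fun p : ℕ => (hY (2 * p + 3)).exists_comp_odd
  have hw' := hw.map (tanhHom : ℝ[X] →+* (ℝ → ℝ))
  refine ⟨X₁, X₂, Y₁, Y₂, fun p => ⟨hX₁ p, hX₂ p, hY₁ p, hY₂ p⟩, PowerSeries.X_pow_dvd_iff.1 hw'.1,
    fun p _ => ?_, fun p hp => ?_, PowerSeries.X_pow_dvd_iff.1 hw'.2, fun p _ => ?_,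
    fun p hp => ?_⟩
  · rw [PowerSeries.coeff_map, eX₁, aeval_eta0_eq]
    rfl
  · obtain ⟨q, rfl⟩ := Nat.exists_eq_add_of_le' hp
    rw [PowerSeries.coeff_map, show 2 * (q + 1) + 1 = 2 * q + 3 by ring, eX₂, deriv_eta0_eq,
      aeval_eta0_eq, Nat.add_sub_cancel, ← map_mul]
    rfl
  · rw [PowerSeries.coeff_map, eY₁, aeval_eta0_eq]
    rfl
  · obtain ⟨q, rfl⟩ := Nat.exists_eq_add_of_le' hp
    rw [PowerSeries.coeff_map, show 2 * (q + 1) + 1 = 2 * q + 3 by ring, eY₂, deriv_eta0_eq,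
      aeval_eta0_eq, Nat.add_sub_cancel, ← map_mul]
    rfl

theorem exists_hasFormalSeparatrix (hh : IsFormalHamiltonian h a b) (ha : 0 < a) (hb : 0 < b) :
    ∃ μ, IsOddSeries μ ∧ 0 < PowerSeries.coeff 1 μ ∧ HasFormalSeparatrix h μ := by
  have hκ : 0 < √(b / a) := Real.sqrt_pos.2 (div_pos hb ha)
  have hm₀ : 0 < √(2 * a * √(b / a)) := Real.sqrt_pos.2 (by positivity)
  obtain ⟨μ, X, Y, hodd, h1, hw, hX, hY, h2, ho⟩ := exists_isOrbit (κ := √(b / a)) hh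
    (by rw [Real.sq_sqrt (div_pos hb ha).le]; field_simp) hκ hm₀ (Real.sq_sqrt (by positivity))
  refine ⟨μ, hodd, by rwa [h1], _, _, hasSeparatrixForm_map hw hX hY, fun hc => ?_,
    (isOrbit_iff hw).1 ho⟩
  have h3 := hc.1
  rw [timeDeriv_map, ← map_zero (PowerSeries.map (tanhHom : ℝ[X] →+* (ℝ → ℝ))),
    map_tanhHom_injective.eq_iff] at h3
  -- The orbit is not constant because `x₀' = -3 κ s η₀` is a nonzero polynomial.
  have h4 := congrArg (PowerSeries.coeff 2) h3
  rw [coeff_coeffDerivation, h2, tDeriv_leadingX, tDeriv_etaPoly, map_zero] at h4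
  simp [etaPoly_ne_zero, hκ.ne'] at h4

end Existence

end FormalSeparatrix

end

theorem mainTheorem4 (h : MvPowerSeries (Fin 3) ℝ) (a b : ℝ) (ha : 0 < a) (hb : 0 < b)
    (hh : FormalSeparatrix.IsFormalHamiltonian h a b) :
    (∃! μ : PowerSeries ℝ, FormalSeparatrix.IsOddSeries μ ∧ 0 < PowerSeries.coeff 1 μ ∧
      FormalSeparatrix.HasFormalSeparatrix h μ) ∧
    (∀ μ ν : PowerSeries ℝ, FormalSeparatrix.IsOddSeries μ → FormalSeparatrix.IsOddSeries ν →
      FormalSeparatrix.HasFormalSeparatrix h μ → FormalSeparatrix.HasFormalSeparatrix h ν →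
      ν = μ ∨ ν = -μ) := by
  refine ⟨?_, fun μ ν hμ hν h1 h2 =>
    FormalSeparatrix.eq_or_eq_neg_of_hasFormalSeparatrix hh ha hb hμ hν h1 h2⟩
  obtain ⟨μ, hodd, hpos, hsep⟩ := FormalSeparatrix.exists_hasFormalSeparatrix hh ha hb
  refine ⟨μ, ⟨hodd, hpos, hsep⟩, fun ν hν => ?_⟩
  rcases FormalSeparatrix.eq_or_eq_neg_of_hasFormalSeparatrix hh ha hb hodd hν.1 hsep hν.2.2 with
    e | e
  · exact e
  · have := hν.2.1
    rw [e, map_neg] at this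
    linarith
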